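/- Let $\alpha,\beta\in\mathbb{R}$ and, for $t\neq0$, $\theta(z)=z\frac{x}{t}+2\alpha z^{2}+4\beta z^{3}$. Let $D=\{(z_j,c_j)\}_{j=1}^{N}$ be reflectionless scattering data of the Hirota equation $iq_t+\alpha(q_{xx}+2|q|^2q)+i\beta(q_{xxx}+6|q|^2q_x)=0$: the $z_j$ are distinct points with $\operatorname{Im}z_j>0$ and $c_j\in\mathbb{C}\setminus\{0\}$. Write $\mathcal Z=\{z_1,\dots,z_N\}$. Let $m(z)=m(x,t;z|D)$ be the solution of the Riemann–Hilbert problem: $m$ is a $2\times2$ matrix function analytic in $\mathbb{C}\setminus(\mathcal Z\cup\mathcal Z^*)$, $m=\mathbb I+O(z^{-1})$ as $z\to\infty$, $\overline{m(\bar z)}=\sigma_2m(z)\sigma_2$, and $m$ has simple poles at the points of $\mathcal Z\cup\mathcal Z^*$ with $$\operatorname*{Res}_{z=z_k}m=\lim_{z\to z_k}m\,Q_k,\quad \operatorname*{Res}_{z=z_k^*}m=\lim_{z\to z_k^*}m\,\sigma_2\overline{Q_k}\sigma_2,\quad Q_k=\begin{pmatrix}0&0\\ c_ke^{2it\theta(z_k)}&0\end{pmatrix}.$$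 (This solution exists and is unique for all $x\in\mathbb R$, $t\ne0$.) For $\triangle\subseteq\mathcal Z$ put $m^{\triangle}(z|D)=m(z|D)\Big(\prod_{z_k\in\triangle}\frac{z-z_k}{z-z_k^*}\Big)^{\sigma_3}$; for given data and given $(x,t)$ let $\triangle^{-}$, $\triangle^{+}$ be the sets of the discrete eigenvalues $z_k$ of these data with $\operatorname{Re}(i\theta(z_k))>0$, respectively $<0$. Let $m_{sol}(x,t;D)=2i\lim_{z\to\infty}(z\,m(x,t;z|D))_{12}$ be the soliton solution with data $D$. For $z\in\mathbb C$ let $v(z)=-4\left[\alpha\operatorname{Re}z+\beta\left(3(\operatorname{Re}z)^2-(\operatorname{Im}z)^2\right)\right]$, the velocity of the one-soliton with eigenvalue $z$ when $\operatorname{Im}z>0$. Let $x_1\le x_2$, $v_1\le v_2$ be real and $C=\{(x,t):x=x_0+vt,\ x_0\in[x_1,x_2],\ v\in[v_1,v_2]\}$. Let $\mathcal K(\mathcal I)=\{z_j\in\mathcal Z: v(z_j)\in[v_1,v_2]\}$, $\mathcal N(\mathcal I)=|\mathcal K(\mathcal I)|$, $D^{\pm}(\mathcal I)=\{(z_j,c_j^{\pm}(\mathcal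 I)):z_j\in\mathcal K(\mathcal I)\}$ with $$c_j^{+}(\mathcal I)=c_j\prod_{v(z_n)>v_2}\Big(\frac{z_j-z_n}{z_j-z_n^*}\Big)^2,\qquad c_j^{-}(\mathcal I)=c_j\prod_{v(z_n)<v_1}\Big(\frac{z_j-z_n}{z_j-z_n^*}\Big)^2,$$ and $$\mu=\tfrac14\min_{z_k\in\mathcal Z\setminus\mathcal K(\mathcal I)}\operatorname{Im}(z_k)\,\operatorname{dist}\big(v(z_k),[v_1,v_2]\big)$$ ($\mu=+\infty$ if $\mathcal K(\mathcal I)=\mathcal Z$; then $O(e^{-8\mu|t|})$ means $O(e^{-8\nu|t|})$ for every real $\nu$). Then, for $(x,t)\in C$ and $t\to\pm\infty$, $$m^{\triangle^{\mp}}(x,t;z|D)=\left(\mathbb I+O(e^{-8\mu|t|})\right)m^{\triangle^{\mp}}(x,t;z|D^{\pm}(\mathcal I)),$$ uniformly in $(x,t)$, and uniformly in those $z\notin\mathcal Z\cup\mathcal Z^*$ whose distance from the removed eigenvalues $\mathcal Z\setminus\mathcal K(\mathcal I)$ and from their conjugates is at least $r$, for every fixed $r>0$. Consequently the $N$-soliton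 solution equals the $\mathcal N(\mathcal I)$-soliton solution with the modified norming constants up to an exponentially small error: for $(x,t)\in C$, $$m_{sol}(x,t;D)=m_{sol}(x,t;D^{\pm}(\mathcal I))+O(e^{-8\mu|t|}),\qquad t\to\pm\infty,$$ uniformly in $(x,t)$. -/

import Mathlib

open Filter Topology Asymptotics

noncomputable section

namespace Hirota

/-- Reflectionless scattering data `{(z_j, c_j)}`: finitely many distinct points `z_j` of the open
upper half-plane (the finite set `Z`) and a nonzero norming constant `c z_j` for each of them.
The values of `c` outside `Z` play no role. -/
structure ReflectionlessData where
  Z : Finset ℂ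
  c : ℂ → ℂ
  im_pos : ∀ z ∈ Z, 0 < z.im
  c_ne_zero : ∀ z ∈ Z, c z ≠ 0

/-- The set of all poles, `𝒵 ∪ 𝒵*`, attached to a finite set of points `𝒵`. -/
def conjUnion (Z : Finset ℂ) : Set ℂ := {w | w ∈ Z ∨ (starRingEnd ℂ) w ∈ Z}

/-- The phase `θ(z) = z x / t + 2 α z² + 4 β z³`. -/
def theta (α β x t : ℝ) (z : ℂ) : ℂ :=
  z * ((x / t : ℝ) : ℂ) + 2 * (α : ℂ) * z ^ 2 + 4 * (β : ℂ) * z ^ 3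

/-- `γ_k(x,t) = c_k exp(2 i t θ(z_k))`. -/
def gammaCoeff (α β : ℝ) (D : ReflectionlessData) (x t : ℝ) (z : ℂ) : ℂ :=
  D.c z * Complex.exp (2 * Complex.I * (t : ℂ) * theta α β x t z)

/-- The nilpotent matrix `Q_k`. -/
def Q (α β : ℝ) (D : ReflectionlessData) (x t : ℝ) (z : ℂ) : Matrix (Fin 2) (Fin 2) ℂ :=
  !![0, 0; gammaCoeff α β D x t z, 0]

/-- The second Pauli matrix. -/
def sigma2 : Matrix (Fin 2) (Fin 2) ℂ := !![0, -Complex.I; Complex.I, 0]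

/-- Entrywise complex conjugation (no transposition). -/
def conjMat (A : Matrix (Fin 2) (Fin 2) ℂ) : Matrix (Fin 2) (Fin 2) ℂ :=
  A.map (starRingEnd ℂ)

/-- `m` has at `w` (at most) a simple pole, with `Res_w m = lim_{z → w} m(z) N`. -/
def ResidueCondition (m : ℂ → Matrix (Fin 2) (Fin 2) ℂ) (w : ℂ)
    (N : Matrix (Fin 2) (Fin 2) ℂ) : Prop :=
  ∃ R : Matrix (Fin 2) (Fin 2) ℂ,
    Tendsto (fun z => (z - w) • m z) (𝓝[≠] w) (𝓝 R) ∧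
    Tendsto (fun z => m z * N) (𝓝[≠] w) (𝓝 R)

/-- `m = m(x,t; · | D)` solves the reflectionless Riemann-Hilbert problem with data `D`
(its values at the poles themselves are irrelevant). -/
structure IsRHSolution (α β : ℝ) (D : ReflectionlessData) (x t : ℝ)
    (m : ℂ → Matrix (Fin 2) (Fin 2) ℂ) : Prop where
  analytic : ∀ i j, DifferentiableOn ℂ (fun z => m z i j) (conjUnion D.Z)ᶜ
  normalized : ∀ i j, (fun z => m z i j - (1 : Matrix (Fin 2) (Fin 2) ℂ) i j)
    =O[Bornology.cobounded ℂ] fun z => z⁻¹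
  symm : ∀ z ∉ conjUnion D.Z,
    conjMat (m ((starRingEnd ℂ) z)) = sigma2 * m z * sigma2
  residue : ∀ w ∈ D.Z, ResidueCondition m w (Q α β D x t w)
  residue_conj : ∀ w ∈ D.Z, ResidueCondition m ((starRingEnd ℂ) w)
    (sigma2 * conjMat (Q α β D x t w) * sigma2)

/-- The partial trace product `s_{11,△}(z) = ∏_{k ∈ △} (z - z_k) / (z - z_k*)`. -/
def s11 (Δ : Finset ℂ) (z : ℂ) : ℂ := ∏ w ∈ Δ, (z - w) / (z - (starRingEnd ℂ) w)

/-- The matrix `m^△(z) = m(z) s_{11,△}(z)^{σ₃}`. -/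
def mDelta (m : ℂ → Matrix (Fin 2) (Fin 2) ℂ) (Δ : Finset ℂ) (z : ℂ) :
    Matrix (Fin 2) (Fin 2) ℂ :=
  m z * Matrix.diagonal ![s11 Δ z, (s11 Δ z)⁻¹]

open Classical in
/-- `△⁻`: the discrete eigenvalues with `Re (i θ(z_k)) > 0`. In the upper half-plane and for
`β > 0` this is the region between the two branches of `Re (i θ) = 0` that emanate from the
stationary points `z₀ < z₁` (the region below the curve if these are not real). -/
def deltaMinus (α β : ℝ) (D : ReflectionlessData) (x t : ℝ) : Finset ℂ :=
  D.Z.filter fun z => 0 < (Complex.I * theta α β x t z).re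

open Classical in
/-- `△⁺`: the discrete eigenvalues with `Re (i θ(z_k)) < 0`. -/
def deltaPlus (α β : ℝ) (D : ReflectionlessData) (x t : ℝ) : Finset ℂ :=
  D.Z.filter fun z => (Complex.I * theta α β x t z).re < 0

/-- The velocity of the one-soliton with eigenvalue `z`. -/
def velocity (α β : ℝ) (z : ℂ) : ℝ := -4 * (α * z.re + β * (3 * z.re ^ 2 - z.im ^ 2))

/-- The space-time cone `C(x₁, x₂, v₁, v₂)`. -/
def cone (x₁ x₂ v₁ v₂ : ℝ) : Set (ℝ × ℝ) :=
  {p | ∃ x₀ ∈ Set.Icc x₁ x₂, ∃ v ∈ Set.Icc v₁ v₂, p.1 = x₀ + v * p.2}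

open Classical in
/-- `𝒦(𝓘)`: the eigenvalues whose solitons travel with a velocity in `[v₁, v₂]`. -/
def keep (α β : ℝ) (D : ReflectionlessData) (v₁ v₂ : ℝ) : Finset ℂ :=
  D.Z.filter fun z => velocity α β z ∈ Set.Icc v₁ v₂

open Classical in
/-- The eigenvalues of solitons faster than the cone. -/
def faster (α β : ℝ) (D : ReflectionlessData) (v₂ : ℝ) : Finset ℂ :=
  D.Z.filter fun z => v₂ < velocity α β z

open Classical in
/-- The eigenvalues of solitons slower than the cone. -/
def slower (α β : ℝ) (D : ReflectionlessData) (v₁ : ℝ) : Finset ℂ :=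
  D.Z.filter fun z => velocity α β z < v₁

/-- `𝒦 ∖ 𝒦(𝓘)`. -/
def removed (α β : ℝ) (D : ReflectionlessData) (v₁ v₂ : ℝ) : Finset ℂ :=
  D.Z \ keep α β D v₁ v₂

theorem s11_ne_zero {D : ReflectionlessData} {F : Finset ℂ} (hF : F ⊆ D.Z) {z : ℂ}
    (hz : z ∈ D.Z) (hzF : z ∉ F) : s11 F z ≠ 0 := by
  refine Finset.prod_ne_zero_iff.mpr fun w hw => div_ne_zero ?_ ?_
  · exact sub_ne_zero.mpr fun h => hzF (h ▸ hw)
  · refine sub_ne_zero.mpr fun h => ?_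
    have h1 := D.im_pos z hz
    have h2 := D.im_pos w (hF hw)
    rw [h, Complex.conj_im] at h1
    linarith

/-- `D⁺(𝓘) = {(z_j, c_j⁺(𝓘)) : z_j ∈ 𝒦(𝓘)}`, where `c_j⁺(𝓘)` is the product of `c_j` and
`∏ ((z_j - z_n) / (z_j - z_n*))²` over the solitons `z_n` faster than the cone. -/
def dataPlus (α β : ℝ) (D : ReflectionlessData) (v₁ v₂ : ℝ) : ReflectionlessData where
  Z := keep α β D v₁ v₂
  c := fun z => D.c z * ∏ w ∈ faster α β D v₂, ((z - w) / (z - (starRingEnd ℂ) w)) ^ 2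
  im_pos := fun z hz => D.im_pos z (Finset.mem_filter.mp hz).1
  c_ne_zero := fun z hz => by
    obtain ⟨h1, h2⟩ := Finset.mem_filter.mp hz
    refine mul_ne_zero (D.c_ne_zero z h1) ?_
    rw [Finset.prod_pow]
    refine pow_ne_zero 2 (s11_ne_zero (Finset.filter_subset _ _) h1 fun h => ?_)
    exact absurd h2.2 (not_le.mpr (Finset.mem_filter.mp h).2)

/-- `D⁻(𝓘) = {(z_j, c_j⁻(𝓘)) : z_j ∈ 𝒦(𝓘)}`, where `c_j⁻(𝓘)` is the product of `c_j` and
`∏ ((z_j - z_n) / (z_j - z_n*))²` over the solitons `z_n` slower than the cone. -/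
def dataMinus (α β : ℝ) (D : ReflectionlessData) (v₁ v₂ : ℝ) : ReflectionlessData where
  Z := keep α β D v₁ v₂
  c := fun z => D.c z * ∏ w ∈ slower α β D v₁, ((z - w) / (z - (starRingEnd ℂ) w)) ^ 2
  im_pos := fun z hz => D.im_pos z (Finset.mem_filter.mp hz).1
  c_ne_zero := fun z hz => by
    obtain ⟨h1, h2⟩ := Finset.mem_filter.mp hz
    refine mul_ne_zero (D.c_ne_zero z h1) ?_
    rw [Finset.prod_pow]
    refine pow_ne_zero 2 (s11_ne_zero (Finset.filter_subset _ _) h1 fun h => ?_)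
    exact absurd h2.1 (not_le.mpr (Finset.mem_filter.mp h).2)

/-- `μ(𝓘) = ¼ min { Im z_k · dist (velocity z_k, [v₁, v₂]) : z_k ∈ 𝒦 ∖ 𝒦(𝓘) }`,
which is `⊤` when no eigenvalue is removed. -/
def mu (α β : ℝ) (D : ReflectionlessData) (v₁ v₂ : ℝ) : EReal :=
  (removed α β D v₁ v₂).inf fun z =>
    ((z.im * Metric.infDist (velocity α β z) (Set.Icc v₁ v₂) / 4 : ℝ) : EReal)

/-- `M(z) = (I + E(z)) M'(z)` with every entry of `E(z)` bounded by `ε`, at all points `z` that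
are not poles and keep a distance at least `r` from the removed eigenvalues `S` and their
conjugates. -/
def LeftClose (D : ReflectionlessData) (S : Finset ℂ) (r ε : ℝ)
    (M M' : ℂ → Matrix (Fin 2) (Fin 2) ℂ) : Prop :=
  ∀ z ∉ conjUnion D.Z, (∀ w ∈ conjUnion S, r ≤ ‖z - w‖) →
    ∃ E : Matrix (Fin 2) (Fin 2) ℂ, (∀ i j, ‖E i j‖ ≤ ε) ∧ M z = (1 + E) * M' z

/-- `q = 2 i lim_{z → ∞} (z m(z))₁₂`, the reconstruction formula for the soliton solution. -/
def Reconstructs (m : ℂ → Matrix (Fin 2) (Fin 2) ℂ) (q : ℂ) : Prop :=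
  Tendsto (fun z => 2 * Complex.I * (z * m z 0 1)) (Bornology.cobounded ℂ) (𝓝 q)

end Hirota

end

/-!
The rows `(f, g)` of a solution of the reflectionless Riemann-Hilbert problem decouple: `f` has poles
only in `Z`, with residues `γ_w g(w)`, and `g` only in `Z*`, with residues `-conj γ_w f(conj w)`
(`IsRowSolution`). With `h*(z) = conj (h (conj z))`, the pair `(-g*, f*)` is again a row solution,
which makes up the second row of `m`.

Everything rests on the Wronskian `σ f b - σ⁻¹ g a` of a row `(f, g)` for the data `D` and a row
`(a, b)` for the data `D'` on a subset of the poles, where `σ` is the Blaschke product of a set `F` of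
removed poles. If `c' = c σ²`, it has removable singularities at the common poles
(`wronskian_residue_common`).

For `D' = D` the Wronskian is therefore constant, by Liouville's theorem. Applied to a row and its
reflection this gives `|f|² + |g|² = |p|² + |q|²` on the real axis, where `(p, q)` is the value at
infinity. By the maximum principle, `g` and the product of `f` with the Blaschke product of `Z` are
bounded in the upper half-plane, whatever the coefficients `γ` are. With `p = q = 0` this is
uniqueness, hence existence, as the problem for the rows is a finite square linear system.

For `D'` with fewer poles the Wronskian is a constant plus a sum of principal parts at the removed
poles (`wronskian_eq_add_sum`). The uniform bounds show that its residue at a removed `w` is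
`O(|γ_w|)` if `w ∉ F`, and `O(|γ_w|⁻¹)` if `w ∈ F` (`exists_wronskian_residue`). By Cramer's rule,
`m σ^σ₃ = (1 + E) m'` where the entries of `1 + E` are, up to sign, such Wronskians, so `E` is small
away from the removed poles, and `z E(z)` has a small limit at infinity (`exists_comparison`).

Finally `|γ_w| = |c_w| exp (2 Im w (v(w) t - x))`. In the cone the exponent at a removed eigenvalue is
at most `-8 μ |t| + O(1)` or at least `8 μ |t| - O(1)`, according to the side of the cone on which the
soliton travels and the sign of `t`. Taking for `F` the eigenvalues with large coefficients, which for
large `|t|` are exactly the removed elements of `△`, one obtains the theorem.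
-/

namespace Hirota

open scoped ComplexConjugate

/-! ### Removable singularities, partial fractions and the maximum principle -/

/-- Riemann's theorem at finitely many points. -/
theorem exists_differentiableOn_of_removable {U : Set ℂ} (hU : IsOpen U) (S : Finset ℂ)
    {F : ℂ → ℂ} (hF : DifferentiableOn ℂ F (U \ S))
    (h : ∀ w ∈ S, Tendsto (fun z => (z - w) * F z) (𝓝[≠] w) (𝓝 0)) :
    ∃ G : ℂ → ℂ, DifferentiableOn ℂ G U ∧ ∀ z ∉ S, G z = F z := by
  classical
  induction S using Finset.induction_on generalizing F with
  | empty => exact ⟨F, by simpa using hF, fun _ _ => rfl⟩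
  | insert a S ha ih =>
    by_cases haU : a ∈ U
    · have hs : U \ (S : Set ℂ) ∈ 𝓝 a :=
        (hU.sdiff S.finite_toSet.isClosed).mem_nhds ⟨haU, by simpa using ha⟩
      have hd : DifferentiableOn ℂ F ((U \ (S : Set ℂ)) \ {a}) :=
        hF.mono fun z hz => ⟨hz.1.1, by
          simp only [Finset.coe_insert, Set.mem_insert_iff, not_or]
          exact ⟨hz.2, hz.1.2⟩⟩
      have ho : (fun z => F z - F a) =o[𝓝[≠] a] fun z => (z - a)⁻¹ := by
        refine (isLittleO_iff_tendsto' ?_).mpr ?_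
        · filter_upwards [self_mem_nhdsWithin] with z hz h0
          exact absurd h0 (inv_ne_zero (sub_ne_zero.mpr hz))
        · have h1 : Tendsto (fun z => (z - a) * F z - (z - a) * F a) (𝓝[≠] a) (𝓝 (0 - 0)) := by
            refine (h a (Finset.mem_insert_self a S)).sub ?_
            have : Tendsto (fun z : ℂ => (z - a) * F a) (𝓝 a) (𝓝 ((a - a) * F a)) :=
              Continuous.tendsto (by fun_prop) a
            simpa using this.mono_left nhdsWithin_le_nhds
          rw [sub_zero] at h1
          refine h1.congr fun z => ?_
          rw [div_inv_eq_mul]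
          ring
      obtain ⟨G, hG, hGF⟩ := ih
        (Complex.differentiableOn_update_limUnder_of_isLittleO hs hd ho) fun w hw => by
          have hwa : w ≠ a := fun e => ha (e ▸ hw)
          refine (h w (Finset.mem_insert_of_mem hw)).congr' ?_
          filter_upwards [mem_nhdsWithin_of_mem_nhds (isOpen_ne.mem_nhds hwa)] with z hz
          rw [Function.update_of_ne hz]
      refine ⟨G, hG, fun z hz => ?_⟩
      rw [Finset.mem_insert, not_or] at hz
      rw [hGF z hz.2, Function.update_of_ne hz.1]
    · obtain ⟨G, hG, hGF⟩ := ih (hF.mono fun z hz => ⟨hz.1, by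
          simp only [Finset.coe_insert, Set.mem_insert_iff, not_or]
          exact ⟨fun e => haU (e ▸ hz.1), hz.2⟩⟩) fun w hw => h w (Finset.mem_insert_of_mem hw)
      exact ⟨G, hG, fun z hz => hGF z fun h' => hz (Finset.mem_insert_of_mem h')⟩

theorem tendsto_sub_mul_nhdsNE {F : ℂ → ℂ} {w l : ℂ} (h : Tendsto F (𝓝[≠] w) (𝓝 l)) :
    Tendsto (fun z => (z - w) * F z) (𝓝[≠] w) (𝓝 0) := by
  have h1 : Tendsto (fun z : ℂ => z - w) (𝓝[≠] w) (𝓝 (w - w)) :=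
    (Continuous.tendsto (by fun_prop) w).mono_left nhdsWithin_le_nhds
  simpa using h1.mul h

theorem tendsto_inv_sub_cobounded (w : ℂ) :
    Tendsto (fun z : ℂ => (z - w)⁻¹) (Bornology.cobounded ℂ) (𝓝 0) :=
  tendsto_inv₀_cobounded.comp (tendsto_sub_const_cobounded w)

theorem tendsto_div_sub_cobounded (w : ℂ) :
    Tendsto (fun z : ℂ => z / (z - w)) (Bornology.cobounded ℂ) (𝓝 1) := by
  have h : Tendsto (fun z : ℂ => 1 + w * (z - w)⁻¹) (Bornology.cobounded ℂ) (𝓝 (1 + w * 0)) :=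
    ((tendsto_inv_sub_cobounded w).const_mul w).const_add 1
  rw [mul_zero, add_zero] at h
  refine h.congr' ?_
  filter_upwards [Bornology.isBounded_def.mp (Bornology.isBounded_singleton (x := w))] with z hz
  have : z - w ≠ 0 := sub_ne_zero.mpr hz
  field_simp
  ring

theorem tendsto_sum_div_sub_cobounded (S : Finset ℂ) (A u : ℂ → ℂ) :
    Tendsto (fun z => ∑ w ∈ S, A w / (z - u w)) (Bornology.cobounded ℂ) (𝓝 0) := by
  have h := tendsto_finsetSum S fun w _ => (tendsto_inv_sub_cobounded (u w)).const_mul (A w)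
  simpa [div_eq_mul_inv] using h

theorem tendsto_mul_sum_div_sub_cobounded (S : Finset ℂ) (A u : ℂ → ℂ) :
    Tendsto (fun z => z * ∑ w ∈ S, A w / (z - u w)) (Bornology.cobounded ℂ)
      (𝓝 (∑ w ∈ S, A w)) := by
  have h := tendsto_finsetSum S fun w _ => (tendsto_div_sub_cobounded (u w)).const_mul (A w)
  simp only [mul_one] at h
  refine h.congr fun z => ?_
  rw [Finset.mul_sum]
  exact Finset.sum_congr rfl fun w _ => by ring

theorem tendsto_sub_mul_sum_div_sub {S : Finset ℂ} (A : ℂ → ℂ) {w : ℂ} (hw : w ∈ S) :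
    Tendsto (fun z => (z - w) * ∑ v ∈ S, A v / (z - v)) (𝓝[≠] w) (𝓝 (A w)) := by
  classical
  have hc : ContinuousAt (fun z => ∑ v ∈ S.erase w, A v / (z - v)) w := by
    refine tendsto_finsetSum _ fun v hv => ?_
    exact ContinuousAt.div (by fun_prop) (by fun_prop)
      (sub_ne_zero.mpr (Finset.ne_of_mem_erase hv).symm)
  have h := (tendsto_sub_mul_nhdsNE (hc.tendsto.mono_left nhdsWithin_le_nhds)).const_add (A w)
  rw [add_zero] at h
  refine h.congr' ?_
  filter_upwards [self_mem_nhdsWithin] with z hz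
  have : z - w ≠ 0 := sub_ne_zero.mpr hz
  rw [← Finset.add_sum_erase S _ hw]
  field_simp

theorem differentiableAt_sum_div_sub (S : Finset ℂ) (A u : ℂ → ℂ) {z : ℂ}
    (hz : ∀ w ∈ S, z ≠ u w) : DifferentiableAt ℂ (fun z => ∑ w ∈ S, A w / (z - u w)) z := by
  refine DifferentiableAt.fun_sum fun w hw => ?_
  exact DifferentiableAt.div (by fun_prop) (by fun_prop) (sub_ne_zero.mpr (hz w hw))

/-- A function with finitely many singularities, all of them at most simple poles, and with a
limit at infinity is the sum of its principal parts and this limit. -/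
theorem eq_add_sum_div_sub {S : Finset ℂ} {F A : ℂ → ℂ} {L : ℂ}
    (hF : DifferentiableOn ℂ F (S : Set ℂ)ᶜ)
    (hA : ∀ w ∈ S, Tendsto (fun z => (z - w) * F z) (𝓝[≠] w) (𝓝 (A w)))
    (hL : Tendsto F (Bornology.cobounded ℂ) (𝓝 L)) {z : ℂ} (hz : z ∉ S) :
    F z = L + ∑ w ∈ S, A w / (z - w) := by
  obtain ⟨G, hG, hGF⟩ := exists_differentiableOn_of_removable (U := Set.univ) isOpen_univ S
    (F := fun z => F z - ∑ w ∈ S, A w / (z - w)) (by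
      rw [← Set.compl_eq_univ_sdiff]
      refine hF.sub fun z hz => (differentiableAt_sum_div_sub S A id ?_).differentiableWithinAt
      rintro w hw rfl
      exact hz hw) fun w hw => by
        have := (hA w hw).sub (tendsto_sub_mul_sum_div_sub A hw)
        rw [sub_self] at this
        exact this.congr fun z => by ring
  have hlim : Tendsto G (cocompact ℂ) (𝓝 L) := by
    rw [← Metric.cobounded_eq_cocompact]
    have h := hL.sub (tendsto_sum_div_sub_cobounded S A id)
    rw [sub_zero] at h
    refine h.congr' ?_
    filter_upwards [(Bornology.isBounded_def.mp S.finite_toSet.isBounded)] with z hz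
    exact (hGF z hz).symm
  have hconst := (differentiableOn_univ.mp hG).apply_eq_of_tendsto_cocompact z hlim
  rw [hGF z hz] at hconst
  rw [← hconst]
  ring

/-- The maximum principle in the closed upper half-plane for functions with a limit at
infinity. -/
theorem norm_le_of_forall_real_norm_le {G : ℂ → ℂ} {L : ℂ} {C : ℝ}
    (hG : ∀ z : ℂ, 0 ≤ z.im → DifferentiableAt ℂ G z)
    (hL : Tendsto G (Bornology.cobounded ℂ) (𝓝 L)) (hLC : ‖L‖ ≤ C)
    (hC : ∀ x : ℝ, ‖G x‖ ≤ C) {z : ℂ} (hz : 0 ≤ z.im) : ‖G z‖ ≤ C := by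
  refine le_of_forall_pos_le_add fun ε hε => ?_
  -- Outside of a large disc `‖G‖ ≤ C + ε`; inside, compare with the boundary of a half-disc.
  have hev : ∀ᶠ z in Bornology.cobounded ℂ, ‖G z‖ ≤ C + ε :=
    (hL.norm.eventually (gt_mem_nhds (by linarith : ‖L‖ < C + ε))).mono fun z hz => hz.le
  obtain ⟨R₀, -, hR₀⟩ := (hasBasis_cobounded_norm (E := ℂ)).eventually_iff.mp hev
  obtain ⟨R, hR1, hR2⟩ : ∃ R, R₀ ≤ R ∧ ‖z‖ ≤ R := ⟨max R₀ ‖z‖, le_max_left _ _, le_max_right _ _⟩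
  by_cases hzr : z.im = 0
  · have : z = (z.re : ℂ) := Complex.ext rfl (by simpa using hzr)
    rw [this]
    linarith [hC z.re]
  set U : Set ℂ := Metric.ball 0 (R + 1) ∩ {z | 0 < z.im}
  have hUo : IsOpen U :=
    Metric.isOpen_ball.inter (isOpen_lt continuous_const Complex.continuous_im)
  have hcl : closure U ⊆ {z | ‖z‖ ≤ R + 1 ∧ 0 ≤ z.im} := by
    refine closure_minimal (fun z hz => ⟨?_, le_of_lt hz.2⟩) ?_
    · exact le_of_lt (by simpa using hz.1)
    · exact (isClosed_le continuous_norm continuous_const).inter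
        (isClosed_le continuous_const Complex.continuous_im)
  refine Complex.norm_le_of_forall_mem_frontier_norm_le (U := U)
    (Metric.isBounded_ball.subset Set.inter_subset_left) ?_ (fun y hy => ?_)
    (subset_closure ⟨by simpa using by linarith, lt_of_le_of_ne hz (Ne.symm hzr)⟩)
  · exact DifferentiableOn.diffContOnCl fun y hy =>
      (hG y (hcl hy).2).differentiableWithinAt
  · rw [hUo.frontier_eq] at hy
    obtain ⟨h1, h2⟩ := hcl hy.1
    rcases h2.lt_or_eq with h3 | h3
    · have : ¬ ‖y‖ < R + 1 := fun h => hy.2 ⟨by simpa using h, h3⟩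
      exact hR₀ (by simp only [Set.mem_ofPred_eq]; linarith)
    · have : y = (y.re : ℂ) := Complex.ext rfl (by simpa using h3.symm)
      rw [this]
      linarith [hC y.re]

/-! ### Blaschke products -/

theorem conj_s11 (S : Finset ℂ) (z : ℂ) : conj (s11 S (conj z)) = (s11 S z)⁻¹ := by
  simp only [s11, map_prod, map_div₀, map_sub, Complex.conj_conj, ← Finset.prod_inv_distrib,
    inv_div]

theorem s11_eq_mul_erase {S : Finset ℂ} {w : ℂ} (hw : w ∈ S) (z : ℂ) :
    s11 S z = (z - w) / (z - conj w) * s11 (S.erase w) z := by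
  classical
  exact (Finset.mul_prod_erase S _ hw).symm

theorem s11_eq_zero {S : Finset ℂ} {w : ℂ} (hw : w ∈ S) : s11 S w = 0 := by
  rw [s11_eq_mul_erase hw, sub_self, zero_div, zero_mul]

theorem s11_ne_zero_of_forall {S : Finset ℂ} {z : ℂ} (hz : ∀ w ∈ S, z ≠ w ∧ z ≠ conj w) :
    s11 S z ≠ 0 :=
  Finset.prod_ne_zero_iff.mpr fun w hw =>
    div_ne_zero (sub_ne_zero.mpr (hz w hw).1) (sub_ne_zero.mpr (hz w hw).2)

theorem differentiableAt_s11 {S : Finset ℂ} {z : ℂ} (hz : ∀ w ∈ S, z ≠ conj w) :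
    DifferentiableAt ℂ (s11 S) z := by
  have : s11 S = fun z => ∏ w ∈ S, (z - w) / (z - conj w) := rfl
  rw [this]
  refine DifferentiableAt.fun_finsetProd fun w hw => ?_
  exact DifferentiableAt.div (by fun_prop) (by fun_prop) (sub_ne_zero.mpr (hz w hw))

theorem tendsto_s11_cobounded (S : Finset ℂ) :
    Tendsto (s11 S) (Bornology.cobounded ℂ) (𝓝 1) := by
  have h : ∀ w ∈ S, Tendsto (fun z : ℂ => (z - w) / (z - conj w)) (Bornology.cobounded ℂ)
      (𝓝 1) := fun w _ => by
    have h1 := (tendsto_div_sub_cobounded (conj w)).sub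
      ((tendsto_inv_sub_cobounded (conj w)).const_mul w)
    rw [mul_zero, sub_zero] at h1
    exact h1.congr fun z => by ring
  have h' := tendsto_finsetProd S h
  rwa [Finset.prod_const_one] at h'

theorem norm_sub_le_norm_sub_conj {w z : ℂ} (hw : 0 < w.im) (hz : 0 ≤ z.im) :
    ‖z - w‖ ≤ ‖z - conj w‖ := by
  rw [← sq_le_sq₀ (norm_nonneg _) (norm_nonneg _), Complex.sq_norm, Complex.sq_norm,
    Complex.normSq_apply, Complex.normSq_apply]
  simp only [Complex.sub_re, Complex.sub_im, Complex.conj_re, Complex.conj_im]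
  nlinarith [mul_nonneg hw.le hz]

theorem norm_s11_le_one {S : Finset ℂ} (hS : ∀ w ∈ S, 0 < w.im) {z : ℂ} (hz : 0 ≤ z.im) :
    ‖s11 S z‖ ≤ 1 := by
  rw [s11, norm_prod]
  refine Finset.prod_le_one (fun _ _ => norm_nonneg _) fun w hw => ?_
  rw [norm_div]
  exact div_le_one_of_le₀ (norm_sub_le_norm_sub_conj (hS w hw) hz) (norm_nonneg _)

theorem ne_conj_of_im_nonneg {w z : ℂ} (hw : 0 < w.im) (hz : 0 ≤ z.im) : z ≠ conj w := by
  rintro rfl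
  rw [Complex.conj_im] at hz
  linarith

/-! ### Rows of solutions of the Riemann-Hilbert problem -/

/-- The Schwarz reflection `h*(z) = conj (h (conj z))`. -/
def reflect (h : ℂ → ℂ) (z : ℂ) : ℂ := conj (h (conj z))

/-- `(f, g)` is a row of a solution of the Riemann-Hilbert problem with poles `Z ∪ Z*` and residue
coefficients `γ`, except that its value at infinity is `(p, q)`: the function `f` has the residues
`γ w * g w` at the points of `Z`, and `g` the residues `-conj (γ w) * f (conj w)` at those of `Z*`.
As `Z` lies in the upper half-plane, `g` is evaluated at regular points, and so is `f`. The
convention `x / 0 = 0` gives `f` and `g` irrelevant values at their own poles. -/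
structure IsRowSolution (Z : Finset ℂ) (γ : ℂ → ℂ) (p q : ℂ) (f g : ℂ → ℂ) : Prop where
  left_eq : ∀ z, f z = p + ∑ w ∈ Z, γ w * g w / (z - w)
  right_eq : ∀ z, g z = q + ∑ w ∈ Z, -(conj (γ w) * f (conj w)) / (z - conj w)

variable {Z K F : Finset ℂ} {γ γ' : ℂ → ℂ} {p q p' q' : ℂ} {f g a b : ℂ → ℂ} {w z : ℂ}

theorem IsRowSolution.reflect (h : IsRowSolution Z γ p q f g) :
    IsRowSolution Z γ (-conj q) (conj p) (-Hirota.reflect g) (Hirota.reflect f) where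
  left_eq z := by
    simp only [Pi.neg_apply, Hirota.reflect]
    rw [h.right_eq (conj z), map_add, map_sum, neg_add, ← Finset.sum_neg_distrib]
    congr 1
    refine Finset.sum_congr rfl fun w _ => ?_
    simp only [map_div₀, map_neg, map_mul, map_sub, Complex.conj_conj]
    ring
  right_eq z := by
    simp only [Pi.neg_apply, Hirota.reflect]
    rw [h.left_eq (conj z), map_add, map_sum]
    congr 1
    refine Finset.sum_congr rfl fun w _ => ?_
    simp only [map_div₀, map_mul, map_sub, Complex.conj_conj]
    ring

theorem IsRowSolution.differentiableAt_left (h : IsRowSolution Z γ p q f g)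
    (hz : ∀ w ∈ Z, z ≠ w) : DifferentiableAt ℂ f z := by
  rw [funext h.left_eq]
  exact (differentiableAt_sum_div_sub Z _ id hz).const_add _

theorem IsRowSolution.differentiableAt_right (h : IsRowSolution Z γ p q f g)
    (hz : ∀ w ∈ Z, z ≠ conj w) : DifferentiableAt ℂ g z := by
  rw [funext h.right_eq]
  exact (differentiableAt_sum_div_sub Z _ conj hz).const_add _

theorem IsRowSolution.tendsto_left (h : IsRowSolution Z γ p q f g) :
    Tendsto f (Bornology.cobounded ℂ) (𝓝 p) := by
  rw [funext h.left_eq]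
  simpa using (tendsto_sum_div_sub_cobounded Z (fun w => γ w * g w) id).const_add p

theorem IsRowSolution.tendsto_right (h : IsRowSolution Z γ p q f g) :
    Tendsto g (Bornology.cobounded ℂ) (𝓝 q) := by
  rw [funext h.right_eq]
  simpa using (tendsto_sum_div_sub_cobounded Z (fun w => -(conj (γ w) * f (conj w))) conj).const_add
    q

theorem IsRowSolution.tendsto_sub_mul_left (h : IsRowSolution Z γ p q f g) (hw : w ∈ Z) :
    Tendsto (fun z => (z - w) * f z) (𝓝[≠] w) (𝓝 (γ w * g w)) := by
  rw [funext h.left_eq]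
  have h1 := tendsto_sub_mul_sum_div_sub (fun w => γ w * g w) hw
  have h2 := (tendsto_sub_mul_nhdsNE (tendsto_const_nhds (x := p) (f := 𝓝[≠] w))).add h1
  rw [zero_add] at h2
  exact h2.congr fun z => by ring

/-- A continuous function keeps its value as its limit along a punctured neighbourhood. -/
theorem tendsto_nhdsNE_of_differentiableAt {h : ℂ → ℂ} (hh : DifferentiableAt ℂ h w) :
    Tendsto h (𝓝[≠] w) (𝓝 (h w)) :=
  hh.continuousAt.tendsto.mono_left nhdsWithin_le_nhds

theorem IsRowSolution.tendsto_right_nhdsNE (hZ : ∀ w ∈ Z, 0 < w.im)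
    (h : IsRowSolution Z γ p q f g) (hw : 0 ≤ w.im) : Tendsto g (𝓝[≠] w) (𝓝 (g w)) :=
  tendsto_nhdsNE_of_differentiableAt
    (h.differentiableAt_right fun v hv => ne_conj_of_im_nonneg (hZ v hv) hw)

/-! ### The Wronskian of two rows -/

/-- The determinant of the rows `(σ f, σ⁻¹ g)` and `(a, b)`. -/
noncomputable def wronskian (σ f g a b : ℂ → ℂ) (z : ℂ) : ℂ := σ z * f z * b z - (σ z)⁻¹ * g z * a z

theorem wronskian_reflect (F : Finset ℂ) (f g a b : ℂ → ℂ) (z : ℂ) :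
    conj (wronskian (s11 F) f g a b (conj z)) =
      wronskian (s11 F) (-reflect g) (reflect f) (-reflect b) (reflect a) z := by
  simp only [wronskian, map_sub, map_mul, map_inv₀, conj_s11, inv_inv, reflect, Pi.neg_apply]
  ring

/-- The Wronskian has a removable singularity at a pole common to both rows, provided that their
coefficients match. -/
theorem wronskian_residue_common (hZ : ∀ w ∈ Z, 0 < w.im) (hKZ : K ⊆ Z) (hF : F ⊆ Z)
    (hFK : Disjoint F K) (hγ : ∀ w ∈ K, γ' w = γ w * s11 F w ^ 2)
    (h : IsRowSolution Z γ p q f g) (h' : IsRowSolution K γ' p' q' a b) (hw : w ∈ K) :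
    Tendsto (fun z => (z - w) * wronskian (s11 F) f g a b z) (𝓝[≠] w) (𝓝 0) := by
  have hwZ := hZ w (hKZ hw)
  have hwF : w ∉ F := fun h => Finset.disjoint_left.mp hFK h hw
  have hσ0 : s11 F w ≠ 0 := s11_ne_zero_of_forall fun v hv =>
    ⟨fun e => hwF (e ▸ hv), ne_conj_of_im_nonneg (hZ v (hF hv)) hwZ.le⟩
  have hσ := tendsto_nhdsNE_of_differentiableAt (w := w) (h := s11 F)
    (differentiableAt_s11 fun v hv => ne_conj_of_im_nonneg (hZ v (hF hv)) hwZ.le)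
  have hb := h'.tendsto_right_nhdsNE (fun v hv => hZ v (hKZ hv)) hwZ.le
  have hg := h.tendsto_right_nhdsNE hZ hwZ.le
  have hlim := ((hσ.mul (h.tendsto_sub_mul_left (hKZ hw))).mul hb).sub
    (((hσ.inv₀ hσ0).mul hg).mul (h'.tendsto_sub_mul_left hw))
  have h0 : s11 F w * (γ w * g w) * b w - (s11 F w)⁻¹ * g w * (γ' w * b w) = 0 := by
    rw [hγ w hw]
    field_simp
    ring
  rw [h0] at hlim
  refine hlim.congr fun z => ?_
  rw [wronskian]
  ring

/-- The residue of the Wronskian at a pole that only the first row has, outside of the Blaschke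
product. -/
theorem wronskian_residue_of_notMem (hZ : ∀ w ∈ Z, 0 < w.im) (hKZ : K ⊆ Z) (hF : F ⊆ Z)
    (h : IsRowSolution Z γ p q f g) (h' : IsRowSolution K γ' p' q' a b)
    (hw : w ∈ Z) (hwK : w ∉ K) (hwF : w ∉ F) :
    Tendsto (fun z => (z - w) * wronskian (s11 F) f g a b z) (𝓝[≠] w)
      (𝓝 (s11 F w * (γ w * g w) * b w)) := by
  have hwZ := hZ w hw
  have hσ0 : s11 F w ≠ 0 := s11_ne_zero_of_forall fun v hv =>
    ⟨fun e => hwF (e ▸ hv), ne_conj_of_im_nonneg (hZ v (hF hv)) hwZ.le⟩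
  have hσ := tendsto_nhdsNE_of_differentiableAt (w := w) (h := s11 F)
    (differentiableAt_s11 fun v hv => ne_conj_of_im_nonneg (hZ v (hF hv)) hwZ.le)
  have hb := h'.tendsto_right_nhdsNE (fun v hv => hZ v (hKZ hv)) hwZ.le
  have hg := h.tendsto_right_nhdsNE hZ hwZ.le
  have ha := tendsto_nhdsNE_of_differentiableAt
    (h'.differentiableAt_left (z := w) fun v hv e => hwK (e ▸ hv))
  have hlim := ((hσ.mul (h.tendsto_sub_mul_left hw)).mul hb).sub
    (tendsto_sub_mul_nhdsNE (((hσ.inv₀ hσ0).mul hg).mul ha))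
  rw [sub_zero] at hlim
  refine hlim.congr fun z => ?_
  rw [wronskian]
  ring

/-- The residue of the Wronskian at a pole that only the first row has and that is a zero of the
Blaschke product. -/
theorem wronskian_residue_of_mem (hZ : ∀ w ∈ Z, 0 < w.im) (hKZ : K ⊆ Z) (hF : F ⊆ Z)
    (h : IsRowSolution Z γ p q f g) (h' : IsRowSolution K γ' p' q' a b)
    (hw : w ∈ Z) (hwK : w ∉ K) (hwF : w ∈ F) :
    Tendsto (fun z => (z - w) * wronskian (s11 F) f g a b z) (𝓝[≠] w)
      (𝓝 (-((w - conj w) / s11 (F.erase w) w * g w * a w))) := by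
  have hwZ := hZ w hw
  have hσ := tendsto_nhdsNE_of_differentiableAt (w := w) (h := s11 F)
    (differentiableAt_s11 fun v hv => ne_conj_of_im_nonneg (hZ v (hF hv)) hwZ.le)
  have hσ' := tendsto_nhdsNE_of_differentiableAt (w := w) (h := s11 (F.erase w))
    (differentiableAt_s11 fun v hv =>
      ne_conj_of_im_nonneg (hZ v (hF (Finset.mem_of_mem_erase hv))) hwZ.le)
  have hσ0 : s11 (F.erase w) w ≠ 0 := s11_ne_zero_of_forall fun v hv =>
    ⟨(Finset.ne_of_mem_erase hv).symm,
      ne_conj_of_im_nonneg (hZ v (hF (Finset.mem_of_mem_erase hv))) hwZ.le⟩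
  have hb := h'.tendsto_right_nhdsNE (fun v hv => hZ v (hKZ hv)) hwZ.le
  have hg := h.tendsto_right_nhdsNE hZ hwZ.le
  have ha := tendsto_nhdsNE_of_differentiableAt
    (h'.differentiableAt_left (z := w) fun v hv e => hwK (e ▸ hv))
  have hsub : Tendsto (fun z => z - conj w) (𝓝[≠] w) (𝓝 (w - conj w)) :=
    (Continuous.tendsto (by fun_prop) w).mono_left nhdsWithin_le_nhds
  have hlim := ((hσ.mul (h.tendsto_sub_mul_left hw)).mul hb).sub
    (((hsub.div hσ' hσ0).mul hg).mul ha)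
  rw [s11_eq_zero hwF, zero_mul, zero_mul, zero_sub] at hlim
  refine hlim.congr' ?_
  filter_upwards [self_mem_nhdsWithin] with z hz
  have hzw : z - w ≠ 0 := sub_ne_zero.mpr hz
  have : (z - conj w) / s11 (F.erase w) z = (z - w) * (s11 F z)⁻¹ := by
    rw [s11_eq_mul_erase hwF, mul_inv, inv_div, ← mul_assoc, mul_div_cancel₀ _ hzw, div_eq_mul_inv]
  simp only [Pi.div_apply]
  rw [this, wronskian]
  ring

open Classical in
/-- The set `Z ∪ Z*` of all poles as a finite set. -/
noncomputable def poles (Z : Finset ℂ) : Finset ℂ := Z ∪ Z.image conj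

theorem mem_poles : z ∈ poles Z ↔ z ∈ conjUnion Z := by
  classical
  simp only [poles, conjUnion, Finset.mem_union, Finset.mem_image, Set.mem_ofPred_eq]
  refine or_congr_right ⟨?_, fun h => ⟨_, h, Complex.conj_conj z⟩⟩
  rintro ⟨w, hw, rfl⟩
  rwa [Complex.conj_conj]

theorem coe_poles (Z : Finset ℂ) : (poles Z : Set ℂ) = conjUnion Z :=
  Set.ext fun _ => mem_poles

theorem ne_of_notMem_conjUnion (hz : z ∉ conjUnion Z) (hw : w ∈ Z) : z ≠ w ∧ z ≠ conj w := by
  constructor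
  · rintro rfl
    exact hz (Or.inl hw)
  · rintro rfl
    exact hz (Or.inr (by rwa [Complex.conj_conj]))

theorem conjUnion_mono (h : K ⊆ Z) : conjUnion K ⊆ conjUnion Z :=
  fun _ hz => hz.imp (@h _) (@h _)

theorem im_ne_zero_of_mem_conjUnion (hZ : ∀ w ∈ Z, 0 < w.im) (hz : z ∈ conjUnion Z) :
    z.im ≠ 0 := by
  rcases hz with h | h
  · exact (hZ z h).ne'
  · have := hZ _ h
    rw [Complex.conj_im] at this
    linarith

theorem tendsto_conj_nhdsNE (w : ℂ) : Tendsto (fun z => conj z) (𝓝[≠] conj w) (𝓝[≠] w) := by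
  refine tendsto_nhdsWithin_iff.mpr ⟨?_, ?_⟩
  · have := (Complex.continuous_conj.tendsto (conj w)).mono_left
      (nhdsWithin_le_nhds (s := {conj w}ᶜ))
    rwa [Complex.conj_conj] at this
  · filter_upwards [self_mem_nhdsWithin] with z hz h
    exact hz (by rw [← (h : conj z = w), Complex.conj_conj]; rfl)

/-- The principal part at `conj w` is the reflection of the principal part at `w`. -/
theorem tendsto_sub_conj_mul {h k : ℂ → ℂ} {A : ℂ} (hk : ∀ z, conj (h (conj z)) = k z)
    (hA : Tendsto (fun z => (z - w) * k z) (𝓝[≠] w) (𝓝 A)) :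
    Tendsto (fun z => (z - conj w) * h z) (𝓝[≠] (conj w)) (𝓝 (conj A)) := by
  refine ((Complex.continuous_conj.tendsto A).comp (hA.comp (tendsto_conj_nhdsNE w))).congr
    fun z => ?_
  simp only [Function.comp, ← hk, map_mul, map_sub, Complex.conj_conj]

theorem sum_poles (hZ : ∀ w ∈ Z, 0 < w.im) (R : ℂ → ℂ) :
    ∑ w ∈ poles Z, R w = ∑ w ∈ Z, (R w + R (conj w)) := by
  classical
  rw [poles, Finset.sum_union, Finset.sum_image, Finset.sum_add_distrib]
  · exact fun x _ y _ h => star_injective h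
  · refine Finset.disjoint_left.mpr fun x hx hx' => ?_
    obtain ⟨y, hy, rfl⟩ := Finset.mem_image.mp hx'
    have h1 := hZ _ hx
    have h2 := hZ _ hy
    rw [Complex.conj_im] at h1
    linarith

/-- The partial fractions of a function with at most simple poles in `Z ∪ Z*`. -/
theorem eq_add_sum_conjUnion (hZ : ∀ w ∈ Z, 0 < w.im) {h A A' : ℂ → ℂ} {L : ℂ}
    (hd : DifferentiableOn ℂ h (conjUnion Z)ᶜ)
    (hA : ∀ w ∈ Z, Tendsto (fun z => (z - w) * h z) (𝓝[≠] w) (𝓝 (A w)))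
    (hA' : ∀ w ∈ Z, Tendsto (fun z => (z - conj w) * h z) (𝓝[≠] (conj w)) (𝓝 (A' w)))
    (hL : Tendsto h (Bornology.cobounded ℂ) (𝓝 L)) (hz : z ∉ conjUnion Z) :
    h z = L + ∑ w ∈ Z, (A w / (z - w) + A' w / (z - conj w)) := by
  classical
  have hnot : ∀ w ∈ Z, conj w ∉ Z := fun w hw hw' =>
    ne_conj_of_im_nonneg (hZ w hw) (hZ _ hw').le rfl
  rw [eq_add_sum_div_sub (S := poles Z) (A := fun v => if v ∈ Z then A v else A' (conj v))
    (by rwa [coe_poles]) ?_ hL (fun h => hz (mem_poles.mp h)), sum_poles hZ]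
  · congr 1
    refine Finset.sum_congr rfl fun w hw => ?_
    rw [if_pos hw, if_neg (hnot w hw), Complex.conj_conj]
  · intro v hv
    by_cases hvZ : v ∈ Z
    · simpa only [if_pos hvZ] using hA v hvZ
    · have hcv : conj v ∈ Z := (mem_poles.mp hv).resolve_left hvZ
      simpa only [if_neg hvZ, Complex.conj_conj] using hA' _ hcv

theorem tendsto_wronskian_cobounded (F : Finset ℂ) (h : IsRowSolution Z γ p q f g)
    (h' : IsRowSolution K γ' p' q' a b) :
    Tendsto (wronskian (s11 F) f g a b) (Bornology.cobounded ℂ) (𝓝 (p * q' - q * p')) := by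
  have hσ := tendsto_s11_cobounded F
  have := ((hσ.mul h.tendsto_left).mul h'.tendsto_right).sub
    (((hσ.inv₀ one_ne_zero).mul h.tendsto_right).mul h'.tendsto_left)
  simp only [one_mul, inv_one] at this
  exact this

/-- The partial fractions of a Wronskian: by reflection it is enough to know the residues of the
Wronskians of the two rows and of their reflections in the upper half-plane. -/
theorem wronskian_eq_add_sum (hZ : ∀ w ∈ Z, 0 < w.im) (hKZ : K ⊆ Z) (hF : F ⊆ Z)
    (h : IsRowSolution Z γ p q f g) (h' : IsRowSolution K γ' p' q' a b) {A A' : ℂ → ℂ}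
    (hA : ∀ w ∈ Z, Tendsto (fun z => (z - w) * wronskian (s11 F) f g a b z) (𝓝[≠] w) (𝓝 (A w)))
    (hA' : ∀ w ∈ Z, Tendsto (fun z => (z - w) *
      wronskian (s11 F) (-reflect g) (reflect f) (-reflect b) (reflect a) z) (𝓝[≠] w)
      (𝓝 (A' w))) (hz : z ∉ conjUnion Z) :
    wronskian (s11 F) f g a b z = (p * q' - q * p') +
      ∑ w ∈ Z, (A w / (z - w) + conj (A' w) / (z - conj w)) := by
  refine eq_add_sum_conjUnion hZ (A' := fun w => conj (A' w)) (fun y hy => ?_) hA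
    (fun w hw => tendsto_sub_conj_mul (wronskian_reflect F f g a b) (hA' w hw))
    (tendsto_wronskian_cobounded F h h') hz
  have hy' : ∀ w ∈ Z, y ≠ w ∧ y ≠ conj w := fun w hw => ne_of_notMem_conjUnion hy hw
  have hσ : DifferentiableAt ℂ (s11 F) y := differentiableAt_s11 fun w hw => (hy' w (hF hw)).2
  have hσ0 : s11 F y ≠ 0 := s11_ne_zero_of_forall fun w hw => hy' w (hF hw)
  have hf := h.differentiableAt_left fun w hw => (hy' w hw).1
  have hg := h.differentiableAt_right fun w hw => (hy' w hw).2
  have ha := h'.differentiableAt_left fun w hw => (hy' w (hKZ hw)).1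
  have hb := h'.differentiableAt_right fun w hw => (hy' w (hKZ hw)).2
  exact (((hσ.mul hf).mul hb).sub (((hσ.inv hσ0).mul hg).mul ha)).differentiableWithinAt

/-- The determinant of two rows of solutions of one Riemann-Hilbert problem is constant. -/
theorem IsRowSolution.det_eq (hZ : ∀ w ∈ Z, 0 < w.im) (h : IsRowSolution Z γ p q f g)
    (h' : IsRowSolution Z γ p' q' a b) (hz : z ∉ conjUnion Z) :
    f z * b z - g z * a z = p * q' - q * p' := by
  have hγ : ∀ w ∈ Z, γ w = γ w * s11 ∅ w ^ 2 := fun w _ => by simp [s11]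
  have key := wronskian_eq_add_sum hZ subset_rfl (Finset.empty_subset Z) h h' (A := 0) (A' := 0)
    (fun w hw => wronskian_residue_common hZ subset_rfl (Finset.empty_subset Z)
      (Finset.disjoint_empty_left Z) hγ h h' hw)
    (fun w hw => wronskian_residue_common hZ subset_rfl (Finset.empty_subset Z)
      (Finset.disjoint_empty_left Z) hγ h.reflect h'.reflect hw) hz
  simpa [wronskian, s11] using key

/-! ### Bounds that are uniform in the residue coefficients -/

/-- Conservation of the norm: on the real axis `|f|² + |g|²` is constant. -/
theorem IsRowSolution.norm_sq_add_norm_sq (hZ : ∀ w ∈ Z, 0 < w.im)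
    (h : IsRowSolution Z γ p q f g) (x : ℝ) :
    ‖f x‖ ^ 2 + ‖g x‖ ^ 2 = ‖p‖ ^ 2 + ‖q‖ ^ 2 := by
  have hx : (x : ℂ) ∉ conjUnion Z := fun hx =>
    im_ne_zero_of_mem_conjUnion hZ hx (Complex.ofReal_im x)
  have key := h.det_eq hZ h.reflect hx
  simp only [Pi.neg_apply, Hirota.reflect, Complex.conj_ofReal, mul_neg, sub_neg_eq_add,
    Complex.mul_conj, Complex.normSq_eq_norm_sq] at key
  exact_mod_cast key

variable {N : ℝ}

theorem IsRowSolution.norm_right_le (hZ : ∀ w ∈ Z, 0 < w.im) (h : IsRowSolution Z γ p q f g)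
    (hN : 0 ≤ N) (hpq : ‖p‖ ^ 2 + ‖q‖ ^ 2 ≤ N ^ 2) (hz : 0 ≤ z.im) : ‖g z‖ ≤ N := by
  refine norm_le_of_forall_real_norm_le (fun y hy => h.differentiableAt_right fun w hw =>
    ne_conj_of_im_nonneg (hZ w hw) hy) h.tendsto_right ?_ (fun x => ?_) hz
  · exact (sq_le_sq₀ (norm_nonneg _) hN).mp (by nlinarith [sq_nonneg ‖p‖])
  · have := h.norm_sq_add_norm_sq hZ x
    exact (sq_le_sq₀ (norm_nonneg _) hN).mp (by nlinarith [sq_nonneg ‖f x‖])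

/-- In the upper half-plane, the Blaschke product compensates for the poles of `f`. -/
theorem IsRowSolution.norm_left_mul_s11_le (hZ : ∀ w ∈ Z, 0 < w.im)
    (h : IsRowSolution Z γ p q f g) (hN : 0 ≤ N) (hpq : ‖p‖ ^ 2 + ‖q‖ ^ 2 ≤ N ^ 2)
    (hz : 0 ≤ z.im) (hzZ : z ∉ Z) : ‖f z * s11 Z z‖ ≤ N := by
  have hU : IsOpen ((Z.image conj : Finset ℂ) : Set ℂ)ᶜ :=
    (Finset.finite_toSet _).isClosed.isOpen_compl
  have hmem : ∀ y ∈ ((Z.image conj : Finset ℂ) : Set ℂ)ᶜ, ∀ w ∈ Z, y ≠ conj w := by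
    rintro y hy w hw rfl
    exact hy (Finset.mem_coe.mpr (Finset.mem_image_of_mem _ hw))
  obtain ⟨G, hG, hGF⟩ := exists_differentiableOn_of_removable hU Z
    (F := fun z => f z * s11 Z z) (fun y hy => by
      refine DifferentiableAt.differentiableWithinAt ?_
      refine (h.differentiableAt_left fun w hw e => hy.2 (by rw [e]; exact hw)).mul ?_
      exact differentiableAt_s11 (hmem y hy.1)) (fun w hw => by
      have hσ := tendsto_nhdsNE_of_differentiableAt (w := w) (h := s11 Z)
        (differentiableAt_s11 fun v hv => ne_conj_of_im_nonneg (hZ v hv) (hZ w hw).le)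
      have := (h.tendsto_sub_mul_left hw).mul hσ
      rw [s11_eq_zero hw, mul_zero] at this
      exact this.congr fun z => mul_assoc _ _ _)
  rw [← hGF z hzZ]
  refine norm_le_of_forall_real_norm_le (L := p) (fun y hy => ?_) ?_ ?_ (fun x => ?_) hz
  · refine hG.differentiableAt (hU.mem_nhds fun hy' => ?_)
    obtain ⟨w, hw, rfl⟩ := Finset.mem_image.mp (Finset.mem_coe.mp hy')
    exact ne_conj_of_im_nonneg (hZ w hw) hy rfl
  · have := h.tendsto_left.mul (tendsto_s11_cobounded Z)
    rw [mul_one] at this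
    refine this.congr' ?_
    filter_upwards [Bornology.isBounded_def.mp Z.finite_toSet.isBounded] with y hy
    exact (hGF y hy).symm
  · exact (sq_le_sq₀ (norm_nonneg _) hN).mp (by nlinarith [sq_nonneg ‖q‖])
  · have hx : (x : ℂ) ∉ Z := fun hx => by simpa using hZ _ hx
    have := h.norm_sq_add_norm_sq hZ x
    rw [hGF x hx, norm_mul]
    have h1 : ‖f x‖ ≤ N :=
      (sq_le_sq₀ (norm_nonneg _) hN).mp (by nlinarith [sq_nonneg ‖g x‖])
    have h2 := norm_s11_le_one hZ (z := (x : ℂ)) (by simp)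
    nlinarith [norm_nonneg (f x), norm_nonneg (s11 Z (x : ℂ))]

/-- A bound for the residues of `f` which does not depend on the residue coefficients. -/
theorem IsRowSolution.norm_residue_mul_le (hZ : ∀ w ∈ Z, 0 < w.im)
    (h : IsRowSolution Z γ p q f g) (hN : 0 ≤ N) (hpq : ‖p‖ ^ 2 + ‖q‖ ^ 2 ≤ N ^ 2)
    (hw : w ∈ Z) : ‖γ w * g w * (s11 (Z.erase w) w / (w - conj w))‖ ≤ N := by
  have hwZ := hZ w hw
  have hσ := tendsto_nhdsNE_of_differentiableAt (w := w) (h := s11 (Z.erase w))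
    (differentiableAt_s11 fun v hv =>
      ne_conj_of_im_nonneg (hZ v (Finset.mem_of_mem_erase hv)) hwZ.le)
  have hsub : Tendsto (fun z => z - conj w) (𝓝[≠] w) (𝓝 (w - conj w)) :=
    (Continuous.tendsto (by fun_prop) w).mono_left nhdsWithin_le_nhds
  have hlim := (h.tendsto_sub_mul_left hw).mul
    (hσ.div hsub (sub_ne_zero.mpr (ne_conj_of_im_nonneg hwZ hwZ.le)))
  refine le_of_tendsto hlim.norm ?_
  have h1 : ∀ᶠ z in 𝓝[≠] w, 0 < z.im :=
    nhdsWithin_le_nhds ((isOpen_lt continuous_const Complex.continuous_im).mem_nhds hwZ)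
  have h2 : ∀ᶠ z in 𝓝[≠] w, z ∉ Z.erase w :=
    nhdsWithin_le_nhds ((Z.erase w).finite_toSet.isClosed.isOpen_compl.mem_nhds (by simp))
  filter_upwards [h1, h2, self_mem_nhdsWithin] with z hz1 hz2 hz3
  have hzZ : z ∉ Z := fun hzZ => hz2 (Finset.mem_erase.mpr ⟨hz3, hzZ⟩)
  have := h.norm_left_mul_s11_le hZ hN hpq hz1.le hzZ
  rw [s11_eq_mul_erase hw] at this
  refine le_of_eq_of_le (congrArg norm ?_) this
  simp only [Pi.div_apply]
  ring

/-! ### Existence and uniqueness -/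

theorem IsRowSolution.eq_zero (hZ : ∀ w ∈ Z, 0 < w.im) (h : IsRowSolution Z γ 0 0 f g) :
    f = 0 ∧ g = 0 := by
  have hg : ∀ w ∈ Z, g w = 0 := fun w hw => norm_le_zero_iff.mp
    (h.norm_right_le hZ le_rfl (by simp) (hZ w hw).le)
  have hf : ∀ w ∈ Z, f (conj w) = 0 := fun w hw => by
    have h0 : Hirota.reflect f w = 0 := norm_le_zero_iff.mp
      (h.reflect.norm_right_le hZ le_rfl (by simp) (hZ w hw).le)
    simpa [Hirota.reflect] using h0
  constructor
  · funext z
    rw [h.left_eq, Finset.sum_eq_zero fun w hw => by rw [hg w hw, mul_zero, zero_div]]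
    simp
  · funext z
    rw [h.right_eq, Finset.sum_eq_zero fun w hw => by rw [hf w hw, mul_zero, neg_zero, zero_div]]
    simp

theorem IsRowSolution.sub (h : IsRowSolution Z γ p q f g) (h' : IsRowSolution Z γ p' q' a b) :
    IsRowSolution Z γ (p - p') (q - q') (f - a) (g - b) where
  left_eq z := by
    rw [Pi.sub_apply, h.left_eq, h'.left_eq, add_sub_add_comm, ← Finset.sum_sub_distrib]
    congr 1
    refine Finset.sum_congr rfl fun w _ => ?_
    rw [Pi.sub_apply]
    ring
  right_eq z := by
    rw [Pi.sub_apply, h.right_eq, h'.right_eq, add_sub_add_comm, ← Finset.sum_sub_distrib]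
    congr 1
    refine Finset.sum_congr rfl fun w _ => ?_
    rw [Pi.sub_apply]
    ring

theorem IsRowSolution.unique (hZ : ∀ w ∈ Z, 0 < w.im) (h : IsRowSolution Z γ p q f g)
    (h' : IsRowSolution Z γ p q a b) : f = a ∧ g = b := by
  have h0 := h.sub h'
  rw [sub_self, sub_self] at h0
  exact (h0.eq_zero hZ).imp sub_eq_zero.mp sub_eq_zero.mp

/-- The linear system for the values of `f` on `Z*` and of `g` on `Z`. -/
noncomputable def rowSystem (Z : Finset ℂ) (γ : ℂ → ℂ) :
    ((Z → ℂ) × (Z → ℂ)) →ₗ[ℂ] (Z → ℂ) × (Z → ℂ) where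
  toFun u := (fun v => u.1 v - ∑ w : Z, γ w * u.2 w / (conj (v : ℂ) - w),
    fun v => u.2 v - ∑ w : Z, -(conj (γ w) * u.1 w) / (v - conj (w : ℂ)))
  map_add' u u' := by
    ext v <;>
    · simp only [Prod.fst_add, Prod.snd_add, Pi.add_apply]
      rw [sub_add_sub_comm, ← Finset.sum_add_distrib]
      congr 1
      exact Finset.sum_congr rfl fun w _ => by ring
  map_smul' c u := by
    ext v <;>
    · simp only [Prod.smul_fst, Prod.smul_snd, Pi.smul_apply, smul_eq_mul, RingHom.id_apply]
      rw [mul_sub, Finset.mul_sum]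
      congr 1
      exact Finset.sum_congr rfl fun w _ => by ring

theorem exists_isRowSolution_of_rowSystem {u : (Z → ℂ) × (Z → ℂ)}
    (hu : rowSystem Z γ u = (fun _ => p, fun _ => q)) :
    ∃ f g, IsRowSolution Z γ p q f g ∧ ∀ w : Z, f (conj (w : ℂ)) = u.1 w ∧ g w = u.2 w := by
  have h1 : ∀ v : Z, p + ∑ w : Z, γ w * u.2 w / (conj (v : ℂ) - w) = u.1 v := fun v => by
    have h : u.1 v - ∑ w : Z, γ w * u.2 w / (conj (v : ℂ) - w) = p :=
      congrFun (congrArg Prod.fst hu) v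
    rw [← h, sub_add_cancel]
  have h2 : ∀ v : Z, q + ∑ w : Z, -(conj (γ w) * u.1 w) / (v - conj (w : ℂ)) = u.2 v :=
    fun v => by
      have h : u.2 v - ∑ w : Z, -(conj (γ w) * u.1 w) / (v - conj (w : ℂ)) = q :=
        congrFun (congrArg Prod.snd hu) v
      rw [← h, sub_add_cancel]
  refine ⟨fun z => p + ∑ w : Z, γ w * u.2 w / (z - w),
    fun z => q + ∑ w : Z, -(conj (γ w) * u.1 w) / (z - conj (w : ℂ)),
    ⟨fun z => ?_, fun z => ?_⟩, fun w => ⟨h1 w, h2 w⟩⟩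
  · rw [← Finset.sum_coe_sort Z]
    simp only [h2]
  · rw [← Finset.sum_coe_sort Z]
    simp only [h1]

theorem exists_isRowSolution (hZ : ∀ w ∈ Z, 0 < w.im) (γ : ℂ → ℂ) (p q : ℂ) :
    ∃ f g, IsRowSolution Z γ p q f g := by
  have hinj : Function.Injective (rowSystem Z γ) := by
    rw [← LinearMap.ker_eq_bot, LinearMap.ker_eq_bot']
    intro u hu
    obtain ⟨f, g, h, hfg⟩ := exists_isRowSolution_of_rowSystem (p := 0) (q := 0) hu
    obtain ⟨rfl, rfl⟩ := h.eq_zero hZ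
    exact Prod.ext (funext fun w => (hfg w).1.symm) (funext fun w => (hfg w).2.symm)
  obtain ⟨u, hu⟩ := LinearMap.injective_iff_surjective.mp hinj (fun _ => p, fun _ => q)
  obtain ⟨f, g, h, -⟩ := exists_isRowSolution_of_rowSystem hu
  exact ⟨f, g, h⟩

/-! ### The matrix problem and its rows -/

theorem IsRowSolution.tendsto_sub_conj_mul_right (h : IsRowSolution Z γ p q f g) (hw : w ∈ Z) :
    Tendsto (fun z => (z - conj w) * g z) (𝓝[≠] (conj w)) (𝓝 (-(conj (γ w) * f (conj w)))) := by
  have h1 := tendsto_sub_conj_mul (h := -g) (fun z => map_neg _ _)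
    (h.reflect.tendsto_sub_mul_left hw)
  simp only [Hirota.reflect, map_mul, Complex.conj_conj, Pi.neg_apply, mul_neg] at h1
  simpa only [neg_neg] using h1.neg

theorem mul_Q_apply (α β : ℝ) (D : ReflectionlessData) (x t : ℝ) (w : ℂ)
    (M : Matrix (Fin 2) (Fin 2) ℂ) (i : Fin 2) :
    (M * Q α β D x t w) i 0 = gammaCoeff α β D x t w * M i 1 ∧ (M * Q α β D x t w) i 1 = 0 := by
  simp [Q, Matrix.mul_apply, Fin.sum_univ_two, mul_comm]

theorem mul_conj_Q_apply (α β : ℝ) (D : ReflectionlessData) (x t : ℝ) (w : ℂ)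
    (M : Matrix (Fin 2) (Fin 2) ℂ) (i : Fin 2) :
    (M * (sigma2 * conjMat (Q α β D x t w) * sigma2)) i 0 = 0 ∧
    (M * (sigma2 * conjMat (Q α β D x t w) * sigma2)) i 1 =
      -(conj (gammaCoeff α β D x t w) * M i 0) := by
  have : sigma2 * conjMat (Q α β D x t w) * sigma2 =
      !![0, -conj (gammaCoeff α β D x t w); 0, 0] := by
    ext i j
    simp only [sigma2, conjMat, Q, Matrix.mul_apply, Fin.sum_univ_two, Matrix.map_apply]
    fin_cases i <;> fin_cases j <;> simp [mul_right_comm]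
  rw [this]
  simp [Matrix.mul_apply, Fin.sum_univ_two, mul_comm]

variable {α β x t : ℝ} {D : ReflectionlessData} {m : ℂ → Matrix (Fin 2) (Fin 2) ℂ}

/-- The residue condition, entry by entry. -/
theorem residueCondition_iff {N : Matrix (Fin 2) (Fin 2) ℂ} :
    ResidueCondition m w N ↔ ∃ R : Matrix (Fin 2) (Fin 2) ℂ, ∀ i j,
      Tendsto (fun z => (z - w) * m z i j) (𝓝[≠] w) (𝓝 (R i j)) ∧
      Tendsto (fun z => (m z * N) i j) (𝓝[≠] w) (𝓝 (R i j)) := by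
  refine exists_congr fun R => ⟨fun h i j => ⟨?_, ?_⟩, fun h => ⟨?_, ?_⟩⟩
  · exact tendsto_pi_nhds.mp (tendsto_pi_nhds.mp h.1 i) j
  · exact tendsto_pi_nhds.mp (tendsto_pi_nhds.mp h.2 i) j
  · exact tendsto_pi_nhds.mpr fun i => tendsto_pi_nhds.mpr fun j => (h i j).1
  · exact tendsto_pi_nhds.mpr fun i => tendsto_pi_nhds.mpr fun j => (h i j).2

theorem eventually_notMem_conjUnion_nhdsNE (Z : Finset ℂ) (w : ℂ) :
    ∀ᶠ z in 𝓝[≠] w, z ∉ conjUnion Z := by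
  have h : ∀ᶠ z in 𝓝[≠] w, z ∉ (poles Z).erase w :=
    nhdsWithin_le_nhds (((poles Z).erase w).finite_toSet.isClosed.isOpen_compl.mem_nhds (by simp))
  filter_upwards [h, self_mem_nhdsWithin] with z hz hzw hz'
  exact hz (Finset.mem_erase.mpr ⟨hzw, mem_poles.mpr hz'⟩)

theorem eventually_notMem_conjUnion_cobounded (Z : Finset ℂ) :
    ∀ᶠ z in Bornology.cobounded ℂ, z ∉ conjUnion Z := by
  have := Bornology.isBounded_def.mp (poles Z).finite_toSet.isBounded
  rwa [coe_poles] at this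

/-- Off the poles, the rows of a solution of the Riemann-Hilbert problem are row solutions. -/
theorem IsRHSolution.exists_row (h : IsRHSolution α β D x t m) (i : Fin 2) :
    ∃ f g, IsRowSolution D.Z (gammaCoeff α β D x t) ((1 : Matrix (Fin 2) (Fin 2) ℂ) i 0)
      ((1 : Matrix (Fin 2) (Fin 2) ℂ) i 1) f g ∧
      ∀ z ∉ conjUnion D.Z, m z i 0 = f z ∧ m z i 1 = g z := by
  have hlim : ∀ j, Tendsto (fun z => m z i j) (Bornology.cobounded ℂ)
      (𝓝 ((1 : Matrix (Fin 2) (Fin 2) ℂ) i j)) := fun j => by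
    have := ((h.normalized i j).trans_tendsto tendsto_inv₀_cobounded).add_const
      ((1 : Matrix (Fin 2) (Fin 2) ℂ) i j)
    simpa using this
  have hR : ∀ w, ∃ R, w ∈ D.Z →
      Tendsto (fun z => (z - w) * m z i 0) (𝓝[≠] w) (𝓝 R) ∧
      Tendsto (fun z => (z - w) * m z i 1) (𝓝[≠] w) (𝓝 0) ∧
      Tendsto (fun z => gammaCoeff α β D x t w * m z i 1) (𝓝[≠] w) (𝓝 R) := fun w => by
    by_cases hw : w ∈ D.Z
    · obtain ⟨R, hR⟩ := residueCondition_iff.mp (h.residue w hw)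
      have h0 := hR i 0
      have h1 := hR i 1
      simp only [mul_Q_apply] at h0 h1
      -- The second column of `m Q` vanishes, so the second column of `m` has residue zero.
      rw [tendsto_nhds_unique h1.2 tendsto_const_nhds] at h1
      exact ⟨R i 0, fun _ => ⟨h0.1, h1.1, h0.2⟩⟩
    · exact ⟨0, fun hw' => absurd hw' hw⟩
  have hR' : ∀ w, ∃ R, w ∈ D.Z →
      Tendsto (fun z => (z - conj w) * m z i 1) (𝓝[≠] (conj w)) (𝓝 R) ∧
      Tendsto (fun z => (z - conj w) * m z i 0) (𝓝[≠] (conj w)) (𝓝 0) ∧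
      Tendsto (fun z => -(conj (gammaCoeff α β D x t w) * m z i 0)) (𝓝[≠] (conj w))
        (𝓝 R) := fun w => by
    by_cases hw : w ∈ D.Z
    · obtain ⟨R, hR⟩ := residueCondition_iff.mp (h.residue_conj w hw)
      have h0 := hR i 0
      have h1 := hR i 1
      simp only [mul_conj_Q_apply] at h0 h1
      rw [tendsto_nhds_unique h0.2 tendsto_const_nhds] at h0
      exact ⟨R i 1, fun _ => ⟨h1.1, h0.1, h1.2⟩⟩
    · exact ⟨0, fun hw' => absurd hw' hw⟩
  choose R hR using hR
  choose R' hR' using hR'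
  set f : ℂ → ℂ := fun z => (1 : Matrix (Fin 2) (Fin 2) ℂ) i 0 + ∑ w ∈ D.Z, R w / (z - w)
    with hf
  set g : ℂ → ℂ := fun z => (1 : Matrix (Fin 2) (Fin 2) ℂ) i 1 +
    ∑ w ∈ D.Z, R' w / (z - conj w) with hg
  have hmf : ∀ z ∉ conjUnion D.Z, m z i 0 = f z := fun z hz => by
    rw [eq_add_sum_conjUnion D.im_pos (A' := 0) (h.analytic i 0) (fun w hw => (hR w hw).1)
      (fun w hw => (hR' w hw).2.1) (hlim 0) hz]
    simp [hf]
  have hmg : ∀ z ∉ conjUnion D.Z, m z i 1 = g z := fun z hz => by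
    rw [eq_add_sum_conjUnion D.im_pos (A := 0) (h.analytic i 1) (fun w hw => (hR w hw).2.1)
      (fun w hw => (hR' w hw).1) (hlim 1) hz]
    simp [hg]
  have hRg : ∀ w ∈ D.Z, R w = gammaCoeff α β D x t w * g w := fun w hw => by
    have hgw : DifferentiableAt ℂ g w := (differentiableAt_sum_div_sub D.Z R' conj fun v hv =>
      ne_conj_of_im_nonneg (D.im_pos v hv) (D.im_pos w hw).le).const_add _
    refine tendsto_nhds_unique (hR w hw).2.2
      (((tendsto_nhdsNE_of_differentiableAt hgw).const_mul _).congr' ?_)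
    filter_upwards [eventually_notMem_conjUnion_nhdsNE D.Z w] with z hz
    rw [hmg z hz]
  have hRf : ∀ w ∈ D.Z, R' w = -(conj (gammaCoeff α β D x t w) * f (conj w)) := fun w hw => by
    have hfw : DifferentiableAt ℂ f (conj w) :=
      (differentiableAt_sum_div_sub D.Z R id fun v hv e => by
        exact ne_conj_of_im_nonneg (D.im_pos w hw) (D.im_pos v hv).le e.symm).const_add _
    refine tendsto_nhds_unique (hR' w hw).2.2
      (((tendsto_nhdsNE_of_differentiableAt hfw).const_mul _).neg.congr' ?_)
    filter_upwards [eventually_notMem_conjUnion_nhdsNE D.Z (conj w)] with z hz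
    rw [hmf z hz]
  refine ⟨f, g, ⟨fun z => ?_, fun z => ?_⟩, fun z hz => ⟨hmf z hz, hmg z hz⟩⟩
  · exact congrArg ((1 : Matrix (Fin 2) (Fin 2) ℂ) i 0 + ·)
      (Finset.sum_congr rfl fun w hw => congrArg (· / _) (hRg w hw))
  · exact congrArg ((1 : Matrix (Fin 2) (Fin 2) ℂ) i 1 + ·)
      (Finset.sum_congr rfl fun w hw => congrArg (· / _) (hRf w hw))

theorem isBigO_sum_div_sub (S : Finset ℂ) (A u : ℂ → ℂ) :
    (fun z => ∑ w ∈ S, A w / (z - u w)) =O[Bornology.cobounded ℂ] fun z => z⁻¹ := by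
  have h := ((tendsto_mul_sum_div_sub_cobounded S A u).isBigO_one ℂ).mul
    (isBigO_refl (fun z : ℂ => z⁻¹) (Bornology.cobounded ℂ))
  simp only [one_mul] at h
  refine h.congr' ?_ EventuallyEq.rfl
  filter_upwards [Bornology.isBounded_def.mp (Bornology.isBounded_singleton (x := (0 : ℂ)))]
    with z hz
  have : z ≠ 0 := hz
  field_simp

theorem IsRowSolution.isBigO (h : IsRowSolution Z γ p q f g) :
    (fun z => f z - p) =O[Bornology.cobounded ℂ] (fun z => z⁻¹) ∧
    (fun z => g z - q) =O[Bornology.cobounded ℂ] (fun z => z⁻¹) := by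
  constructor
  · refine (isBigO_sum_div_sub Z (fun w => γ w * g w) id).congr_left fun z => ?_
    rw [h.left_eq z, add_sub_cancel_left]
    rfl
  · refine (isBigO_sum_div_sub Z (fun w => -(conj (γ w) * f (conj w))) conj).congr_left
      fun z => ?_
    rw [h.right_eq z, add_sub_cancel_left]

/-- A row solution and its reflection together solve the Riemann-Hilbert problem. -/
theorem isRHSolution_of_isRowSolution
    (h : IsRowSolution D.Z (gammaCoeff α β D x t) 1 0 f g) :
    IsRHSolution α β D x t fun z => !![f z, g z; -reflect g z, reflect f z] := by
  have h' := h.reflect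
  rw [map_zero, map_one, neg_zero] at h'
  have hrow : ∀ i : Fin 2, ∃ f' g', IsRowSolution D.Z (gammaCoeff α β D x t)
      ((1 : Matrix (Fin 2) (Fin 2) ℂ) i 0) ((1 : Matrix (Fin 2) (Fin 2) ℂ) i 1) f' g' ∧
      ∀ z, !![f z, g z; -reflect g z, reflect f z] i 0 = f' z ∧
        !![f z, g z; -reflect g z, reflect f z] i 1 = g' z :=
    Fin.forall_fin_two.mpr ⟨⟨f, g, by simpa using h, fun z => ⟨rfl, rfl⟩⟩,
      ⟨-reflect g, reflect f, by simpa using h', fun z => ⟨rfl, rfl⟩⟩⟩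
  choose f' g' hrow hm using hrow
  refine ⟨fun i j => ?_, fun i j => ?_, fun z _ => ?_, fun w hw => ?_, fun w hw => ?_⟩
  · fin_cases j
    · refine DifferentiableOn.congr (f := f' i) (fun z hz => ?_) fun z _ => (hm i z).1
      exact ((hrow i).differentiableAt_left fun w hw =>
        (ne_of_notMem_conjUnion hz hw).1).differentiableWithinAt
    · refine DifferentiableOn.congr (f := g' i) (fun z hz => ?_) fun z _ => (hm i z).2
      exact ((hrow i).differentiableAt_right fun w hw =>
        (ne_of_notMem_conjUnion hz hw).2).differentiableWithinAt
  · fin_cases j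
    · exact (hrow i).isBigO.1.congr_left fun z => by rw [← (hm i z).1]; rfl
    · exact (hrow i).isBigO.2.congr_left fun z => by rw [← (hm i z).2]; rfl
  · ext i j
    fin_cases i <;> fin_cases j <;>
      simp [conjMat, sigma2, reflect, Matrix.mul_apply, Fin.sum_univ_two, mul_right_comm]
  · refine residueCondition_iff.mpr
      ⟨Matrix.of fun i => ![gammaCoeff α β D x t w * g' i w, 0], fun i j => ?_⟩
    have hg := (hrow i).tendsto_right_nhdsNE D.im_pos (D.im_pos w hw).le
    fin_cases j
    · refine ⟨((hrow i).tendsto_sub_mul_left hw).congr fun z => ?_,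
        (hg.const_mul _).congr fun z => ?_⟩
      · exact congrArg _ (hm i z).1.symm
      · exact ((mul_Q_apply α β D x t w _ i).1.trans (congrArg _ (hm i z).2)).symm
    · refine ⟨(tendsto_sub_mul_nhdsNE hg).congr fun z => ?_,
        tendsto_const_nhds.congr fun z => ?_⟩
      · exact congrArg _ (hm i z).2.symm
      · exact (mul_Q_apply α β D x t w _ i).2.symm
  · refine residueCondition_iff.mpr ⟨Matrix.of fun i =>
      ![0, -(conj (gammaCoeff α β D x t w) * f' i (conj w))], fun i j => ?_⟩
    have hf := tendsto_nhdsNE_of_differentiableAt ((hrow i).differentiableAt_left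
      (z := conj w) fun v hv e => ne_conj_of_im_nonneg (D.im_pos w hw) (D.im_pos v hv).le e.symm)
    fin_cases j
    · refine ⟨(tendsto_sub_mul_nhdsNE hf).congr fun z => ?_,
        tendsto_const_nhds.congr fun z => ?_⟩
      · exact congrArg _ (hm i z).1.symm
      · exact (mul_conj_Q_apply α β D x t w _ i).1.symm
    · refine ⟨((hrow i).tendsto_sub_conj_mul_right hw).congr fun z => ?_,
        (hf.const_mul _).neg.congr fun z => ?_⟩
      · exact congrArg _ (hm i z).2.symm
      · exact ((mul_conj_Q_apply α β D x t w _ i).2.trans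
          (congrArg (fun u => -(_ * u)) (hm i z).1)).symm

theorem exists_isRHSolution (α β : ℝ) (D : ReflectionlessData) (x t : ℝ) :
    ∃ m, IsRHSolution α β D x t m := by
  obtain ⟨f, g, h⟩ := exists_isRowSolution D.im_pos (gammaCoeff α β D x t) 1 0
  exact ⟨_, isRHSolution_of_isRowSolution h⟩

theorem IsRHSolution.eqOn {m' : ℂ → Matrix (Fin 2) (Fin 2) ℂ} (h' : IsRHSolution α β D x t m')
    (h : IsRHSolution α β D x t m) : Set.EqOn m' m (conjUnion D.Z)ᶜ := by
  intro z hz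
  ext i j
  obtain ⟨f, g, hfg, hm⟩ := h.exists_row i
  obtain ⟨f', g', hfg', hm'⟩ := h'.exists_row i
  obtain ⟨rfl, rfl⟩ := hfg.unique D.im_pos hfg'
  fin_cases j
  · exact (hm' z hz).1.trans (hm z hz).1.symm
  · exact (hm' z hz).2.trans (hm z hz).2.symm

variable {κ : ℝ}

/-! ### Comparison of two Riemann-Hilbert problems -/

/-- A constant, depending only on the poles, that controls the residues of Wronskians. -/
noncomputable def residueBound (Z K F : Finset ℂ) (w : ℂ) : ℝ :=
  1 + ‖(w - conj w) / s11 (F.erase w) w‖ * ‖(w - conj w) / s11 (Z.erase w) w‖ * ‖(s11 K w)⁻¹‖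

theorem one_le_residueBound (Z K F : Finset ℂ) (w : ℂ) : 1 ≤ residueBound Z K F w :=
  le_add_of_nonneg_right (by positivity)

/-- The residues of the Wronskian of a normalized row for `(Z, γ)` and one for the smaller pole set
`K` are small if `γ` is small on `Z ∖ K ∖ F` and large on `F`, whatever `γ` is on `K`. -/
theorem exists_wronskian_residue (hZ : ∀ w ∈ Z, 0 < w.im) (hKZ : K ⊆ Z) (hF : F ⊆ Z)
    (hFK : Disjoint F K) (hγ : ∀ w ∈ K, γ' w = γ w * s11 F w ^ 2) (hκ : 0 ≤ κ)
    (hsmall : ∀ w ∈ Z, w ∉ K → w ∉ F → ‖γ w‖ ≤ κ) (hlarge : ∀ w ∈ F, 1 ≤ κ * ‖γ w‖)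
    (h : IsRowSolution Z γ p q f g) (hpq : ‖p‖ ^ 2 + ‖q‖ ^ 2 ≤ 1 ^ 2)
    (h' : IsRowSolution K γ' p' q' a b) (hpq' : ‖p'‖ ^ 2 + ‖q'‖ ^ 2 ≤ 1 ^ 2) (hw : w ∈ Z) :
    ∃ A, Tendsto (fun z => (z - w) * wronskian (s11 F) f g a b z) (𝓝[≠] w) (𝓝 A) ∧
      ‖A‖ ≤ residueBound Z K F w * κ ∧ (w ∈ K → A = 0) := by
  have hwZ := hZ w hw
  have hK : ∀ w ∈ K, 0 < w.im := fun w hw => hZ w (hKZ hw)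
  by_cases hwK : w ∈ K
  · exact ⟨0, wronskian_residue_common hZ hKZ hF hFK hγ h h' hwK, by
      rw [norm_zero]
      exact mul_nonneg (zero_le_one.trans (one_le_residueBound Z K F w)) hκ, fun _ => rfl⟩
  -- In `F`, the bound for `γ w * g w` from the maximum principle makes `g w` itself small.
  by_cases hwF : w ∈ F
  · refine ⟨_, wronskian_residue_of_mem hZ hKZ hF h h' hw hwK hwF, ?_, fun h => absurd h hwK⟩
    have hne : ∀ v ∈ Z, w ≠ conj v := fun v hv => ne_conj_of_im_nonneg (hZ v hv) hwZ.le
    have hs : s11 (Z.erase w) w / (w - conj w) ≠ 0 := by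
      refine div_ne_zero (s11_ne_zero_of_forall fun v hv => ⟨(Finset.ne_of_mem_erase hv).symm,
        hne v (Finset.mem_of_mem_erase hv)⟩) (sub_ne_zero.mpr (hne w hw))
    have hK0 : s11 K w ≠ 0 := s11_ne_zero_of_forall fun v hv =>
      ⟨fun e => hwK (e ▸ hv), hne v (hKZ hv)⟩
    have hg : ‖g w‖ ≤ κ * ‖(w - conj w) / s11 (Z.erase w) w‖ := by
      have h1 := h.norm_residue_mul_le hZ zero_le_one hpq hw
      rw [norm_mul, ← le_div_iff₀ (norm_pos_iff.mpr hs), one_div, ← norm_inv, inv_div,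
        norm_mul] at h1
      calc ‖g w‖ ≤ κ * ‖γ w‖ * ‖g w‖ := le_mul_of_one_le_left (norm_nonneg _) (hlarge w hwF)
        _ = κ * (‖γ w‖ * ‖g w‖) := mul_assoc _ _ _
        _ ≤ _ := mul_le_mul_of_nonneg_left h1 hκ
    have ha : ‖a w‖ ≤ ‖(s11 K w)⁻¹‖ := by
      have h1 := h'.norm_left_mul_s11_le hK zero_le_one hpq' hwZ.le hwK
      rwa [norm_mul, ← le_div_iff₀ (norm_pos_iff.mpr hK0), one_div, ← norm_inv] at h1
    rw [norm_neg, norm_mul, norm_mul]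
    calc _ ≤ ‖(w - conj w) / s11 (F.erase w) w‖ * (κ * ‖(w - conj w) / s11 (Z.erase w) w‖) *
          ‖(s11 K w)⁻¹‖ := by gcongr
      _ ≤ residueBound Z K F w * κ := by
        rw [residueBound]
        linarith
  · refine ⟨_, wronskian_residue_of_notMem hZ hKZ hF h h' hw hwK hwF, ?_, fun h => absurd h hwK⟩
    have hσ := norm_s11_le_one (fun v hv => hZ v (hF hv)) hwZ.le (S := F)
    have hg := h.norm_right_le hZ zero_le_one hpq hwZ.le
    have hb := h'.norm_right_le hK zero_le_one hpq' hwZ.le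
    rw [norm_mul, norm_mul, norm_mul]
    calc _ ≤ 1 * (κ * 1) * 1 := by
          gcongr
          exact hsmall w hw hwK hwF
      _ = 1 * κ := by ring
      _ ≤ _ := mul_le_mul_of_nonneg_right (one_le_residueBound Z K F w) hκ

/-- The Wronskian of normalized rows is close to its value at infinity, away from the poles that
the two Riemann-Hilbert problems do not share. -/
theorem norm_wronskian_sub_le (hZ : ∀ w ∈ Z, 0 < w.im) (hKZ : K ⊆ Z) (hF : F ⊆ Z)
    (hFK : Disjoint F K) (hγ : ∀ w ∈ K, γ' w = γ w * s11 F w ^ 2) (hκ : 0 ≤ κ)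
    (hsmall : ∀ w ∈ Z, w ∉ K → w ∉ F → ‖γ w‖ ≤ κ) (hlarge : ∀ w ∈ F, 1 ≤ κ * ‖γ w‖)
    (h : IsRowSolution Z γ p q f g) (hpq : ‖p‖ ^ 2 + ‖q‖ ^ 2 ≤ 1 ^ 2)
    (h' : IsRowSolution K γ' p' q' a b) (hpq' : ‖p'‖ ^ 2 + ‖q'‖ ^ 2 ≤ 1 ^ 2) :
    (∀ r > 0, ∀ z ∉ conjUnion Z, (∀ w ∈ conjUnion (Z \ K), r ≤ ‖z - w‖) →
      ‖wronskian (s11 F) f g a b z - (p * q' - q * p')‖ ≤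
        2 * (∑ w ∈ Z, residueBound Z K F w) * κ / r) ∧
    ∃ l, ‖l‖ ≤ 2 * (∑ w ∈ Z, residueBound Z K F w) * κ ∧
      Tendsto (fun z => z * (wronskian (s11 F) f g a b z - (p * q' - q * p')))
        (Bornology.cobounded ℂ) (𝓝 l) := by
  have hA : ∀ w, ∃ A, w ∈ Z →
      Tendsto (fun z => (z - w) * wronskian (s11 F) f g a b z) (𝓝[≠] w) (𝓝 A) ∧
        ‖A‖ ≤ residueBound Z K F w * κ ∧ (w ∈ K → A = 0) := fun w => by
    by_cases hw : w ∈ Z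
    · obtain ⟨A, hA⟩ := exists_wronskian_residue hZ hKZ hF hFK hγ hκ hsmall hlarge h hpq h' hpq' hw
      exact ⟨A, fun _ => hA⟩
    · exact ⟨0, fun hw' => absurd hw' hw⟩
  have hA' : ∀ w, ∃ A, w ∈ Z → Tendsto (fun z => (z - w) *
      wronskian (s11 F) (-reflect g) (reflect f) (-reflect b) (reflect a) z) (𝓝[≠] w) (𝓝 A) ∧
        ‖A‖ ≤ residueBound Z K F w * κ ∧ (w ∈ K → A = 0) := fun w => by
    by_cases hw : w ∈ Z
    · obtain ⟨A, hA⟩ := exists_wronskian_residue hZ hKZ hF hFK hγ hκ hsmall hlarge h.reflect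
        (by rwa [norm_neg, RCLike.norm_conj, RCLike.norm_conj, add_comm]) h'.reflect
        (by rwa [norm_neg, RCLike.norm_conj, RCLike.norm_conj, add_comm]) hw
      exact ⟨A, fun _ => hA⟩
    · exact ⟨0, fun hw' => absurd hw' hw⟩
  choose A hA using hA
  choose A' hA' using hA'
  have key : ∀ z ∉ conjUnion Z, wronskian (s11 F) f g a b z - (p * q' - q * p') =
      ∑ w ∈ Z, (A w / (z - w) + conj (A' w) / (z - conj w)) := fun z hz => by
    rw [wronskian_eq_add_sum hZ hKZ hF h h' (fun w hw => (hA w hw).1) (fun w hw => (hA' w hw).1) hz,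
      add_sub_cancel_left]
  refine ⟨fun r hr z hz hzr => ?_, ∑ w ∈ Z, A w + ∑ w ∈ Z, conj (A' w), ?_, ?_⟩
  · have hquot : ∀ w ∈ Z, ∀ B u : ℂ, ‖B‖ ≤ residueBound Z K F w * κ → (w ∈ K → B = 0) →
        (w ∉ K → r ≤ ‖z - u‖) → ‖B / (z - u)‖ ≤ residueBound Z K F w * κ / r := by
      intro w _ B u hB hB0 hu
      by_cases hwK : w ∈ K
      · rw [hB0 hwK, zero_div, norm_zero]
        exact div_nonneg (mul_nonneg (zero_le_one.trans (one_le_residueBound Z K F w)) hκ) hr.le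
      · rw [norm_div]
        exact div_le_div₀ ((norm_nonneg B).trans hB) hB hr (hu hwK)
    rw [key z hz, mul_assoc, mul_div_assoc, Finset.sum_mul, Finset.sum_div, Finset.mul_sum]
    refine (norm_sum_le _ _).trans (Finset.sum_le_sum fun w hw => ?_)
    rw [two_mul]
    refine (norm_add_le _ _).trans (add_le_add ?_ ?_)
    · exact hquot w hw _ _ (hA w hw).2.1 (hA w hw).2.2 fun hwK =>
        hzr w (Or.inl (Finset.mem_sdiff.mpr ⟨hw, hwK⟩))
    · refine hquot w hw _ _ (by rw [RCLike.norm_conj]; exact (hA' w hw).2.1)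
        (fun hwK => by rw [(hA' w hw).2.2 hwK, map_zero]) fun hwK => hzr _ (Or.inr ?_)
      rw [Complex.conj_conj]
      exact Finset.mem_sdiff.mpr ⟨hw, hwK⟩
  · rw [mul_assoc, Finset.sum_mul, two_mul]
    refine (norm_add_le _ _).trans (add_le_add ?_ ?_)
    · exact norm_sum_le_of_le _ fun w hw => (hA w hw).2.1
    · exact norm_sum_le_of_le _ fun w hw => by rw [RCLike.norm_conj]; exact (hA' w hw).2.1
  · refine ((tendsto_mul_sum_div_sub_cobounded Z A id).add
      (tendsto_mul_sum_div_sub_cobounded Z (fun w => conj (A' w)) conj)).congr' ?_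
    filter_upwards [eventually_notMem_conjUnion_cobounded Z] with z hz
    rw [key z hz, Finset.sum_add_distrib, mul_add]
    rfl

theorem IsRowSolution.tendsto_mul_right (h : IsRowSolution Z γ p 0 f g) :
    ∃ l, Tendsto (fun z => z * g z) (Bornology.cobounded ℂ) (𝓝 l) :=
  ⟨_, (tendsto_mul_sum_div_sub_cobounded Z (fun w => -(conj (γ w) * f (conj w))) conj).congr
    fun z => by rw [h.right_eq z, zero_add]⟩

/-- The solution with data `D` is close to the one with the data `D'`, in which some poles are
removed and the effect of those in `F`, whose coefficients are large, is encoded in the norming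
constants. The error is bounded by the small coefficients and by the inverses of the large ones. -/
theorem exists_comparison (D D' : ReflectionlessData) (hKZ : D'.Z ⊆ D.Z) (hF : F ⊆ D.Z)
    (hFK : Disjoint F D'.Z) (hc : ∀ w ∈ D'.Z, D'.c w = D.c w * s11 F w ^ 2) {r : ℝ} (hr : 0 < r) :
    ∃ C, 0 ≤ C ∧ ∀ (α β x t κ : ℝ), 0 ≤ κ →
      (∀ w ∈ D.Z, w ∉ D'.Z → w ∉ F → ‖gammaCoeff α β D x t w‖ ≤ κ) →
      (∀ w ∈ F, 1 ≤ κ * ‖gammaCoeff α β D x t w‖) →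
      ∀ Δ Δ' : Finset ℂ, (∀ z, s11 Δ z = s11 F z * s11 Δ' z) →
      ∀ m mI, IsRHSolution α β D x t m → IsRHSolution α β D' x t mI →
        LeftClose D (D.Z \ D'.Z) r (C * κ) (mDelta m Δ) (mDelta mI Δ') ∧
        ∃ q qI : ℂ, Reconstructs m q ∧ Reconstructs mI qI ∧ ‖q - qI‖ ≤ C * κ := by
  set B := 2 * ∑ w ∈ D.Z, residueBound D.Z D'.Z F w with hB
  have hB0 : 0 ≤ B := mul_nonneg zero_le_two (Finset.sum_nonneg fun w _ =>
    zero_le_one.trans (one_le_residueBound _ _ _ w))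
  refine ⟨B / r + 2 * B, by positivity, ?_⟩
  intro α β x t κ hκ hsmall hlarge Δ Δ' hΔ m mI hm hmI
  have hγ : ∀ w ∈ D'.Z, gammaCoeff α β D' x t w = gammaCoeff α β D x t w * s11 F w ^ 2 :=
    fun w hw => by
      rw [gammaCoeff, gammaCoeff, hc w hw]
      ring
  choose f g hfg hmfg using hm.exists_row
  choose a b hab hmab using hmI.exists_row
  have hone : ∀ i : Fin 2, ‖(1 : Matrix (Fin 2) (Fin 2) ℂ) i 0‖ ^ 2 +
      ‖(1 : Matrix (Fin 2) (Fin 2) ℂ) i 1‖ ^ 2 ≤ 1 ^ 2 :=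
    Fin.forall_fin_two.mpr ⟨by simp, by simp⟩
  have hW := fun i j => norm_wronskian_sub_le D.im_pos hKZ hF hFK hγ hκ hsmall hlarge (hfg i)
    (hone i) (hab j) (hone j)
  rw [← hB] at hW
  have hdet : ∀ z ∉ conjUnion D.Z, a 0 z * b 1 z - b 0 z * a 1 z = 1 := fun z hz => by
    have := (hab 0).det_eq D'.im_pos (hab 1) (fun h => hz (conjUnion_mono hKZ h))
    simpa using this
  -- By Cramer's rule, `m σ^σ₃ = B mI` for a matrix `B` of Wronskians.
  have hrow1 : ∀ i, ∀ z ∉ conjUnion D.Z, s11 F z * f i z =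
      wronskian (s11 F) (f i) (g i) (a 1) (b 1) z * a 0 z -
        wronskian (s11 F) (f i) (g i) (a 0) (b 0) z * a 1 z := fun i z hz => by
    rw [wronskian, wronskian]
    linear_combination -(s11 F z * f i z) * hdet z hz
  have hrow2 : ∀ i, ∀ z ∉ conjUnion D.Z, (s11 F z)⁻¹ * g i z =
      wronskian (s11 F) (f i) (g i) (a 1) (b 1) z * b 0 z -
        wronskian (s11 F) (f i) (g i) (a 0) (b 0) z * b 1 z := fun i z hz => by
    rw [wronskian, wronskian]
    linear_combination -((s11 F z)⁻¹ * g i z) * hdet z hz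
  constructor
  · intro z hz hzr
    refine ⟨Matrix.of fun i => ![wronskian (s11 F) (f i) (g i) (a 1) (b 1) z -
      (1 : Matrix (Fin 2) (Fin 2) ℂ) i 0, -wronskian (s11 F) (f i) (g i) (a 0) (b 0) z -
      (1 : Matrix (Fin 2) (Fin 2) ℂ) i 1], fun i j => ?_, ?_⟩
    · have hle : B * κ / r ≤ (B / r + 2 * B) * κ := by
        rw [add_mul, div_mul_eq_mul_div]
        have := mul_nonneg hB0 hκ
        linarith
      refine le_trans ?_ hle
      fin_cases j
      · simpa using (hW i 1).1 r hr z hz hzr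
      · have := (hW i 0).1 r hr z hz hzr
        rw [← norm_neg] at this
        simpa [sub_eq_add_neg, add_comm] using this
    · have hz' : z ∉ conjUnion D'.Z := fun h => hz (conjUnion_mono hKZ h)
      ext i j
      have e0 := hrow1 i z hz
      have e1 := hrow2 i z hz
      fin_cases j
      · simp [mDelta, Matrix.mul_apply, Fin.sum_univ_two, hΔ, (hmfg i z hz).1, (hmab 0 z hz').1,
          (hmab 1 z hz').1]
        linear_combination s11 Δ' z * e0
      · simp [mDelta, Matrix.mul_apply, Fin.sum_univ_two, hΔ, (hmfg i z hz).2, (hmab 0 z hz').2,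
          (hmab 1 z hz').2]
        linear_combination (s11 Δ' z)⁻¹ * e1
  · have h0 := hfg 0
    have h0I := hab 0
    have h1I := hab 1
    have hW0 := (hW 0 0).2
    have hW1 := tendsto_wronskian_cobounded F h0 h1I
    simp only [Matrix.one_apply_eq, ne_eq, zero_ne_one, one_ne_zero, not_false_eq_true,
      Matrix.one_apply_ne, mul_zero, sub_zero, mul_one] at h0 h0I h1I hW0 hW1
    obtain ⟨l, hl⟩ := h0.tendsto_mul_right
    obtain ⟨lI, hlI⟩ := h0I.tendsto_mul_right
    obtain ⟨d, hd, hld⟩ := hW0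
    have hlim : l = lI - d := by
      have e1 := ((tendsto_s11_cobounded F).inv₀ one_ne_zero).mul hl
      have e2 := (hW1.mul hlI).sub (hld.mul h1I.tendsto_right)
      rw [inv_one, one_mul] at e1
      rw [one_mul, mul_one] at e2
      refine tendsto_nhds_unique e1 (e2.congr' ?_)
      filter_upwards [eventually_notMem_conjUnion_cobounded D.Z] with z hz
      linear_combination -z * hrow2 0 z hz
    refine ⟨2 * Complex.I * l, 2 * Complex.I * lI, ?_, ?_, ?_⟩
    · refine (hl.const_mul _).congr' ?_
      filter_upwards [eventually_notMem_conjUnion_cobounded D.Z] with z hz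
      rw [(hmfg 0 z hz).2]
    · refine (hlI.const_mul _).congr' ?_
      filter_upwards [eventually_notMem_conjUnion_cobounded D'.Z] with z hz
      rw [(hmab 0 z hz).2]
    · rw [hlim, ← mul_sub, sub_sub_cancel_left, norm_mul, norm_neg, norm_mul, Complex.norm_I,
        mul_one, Complex.norm_ofNat]
      have : 0 ≤ B / r * κ := by positivity
      linarith

variable {v₁ v₂ x₁ x₂ : ℝ} {Δ Δ' : Finset ℂ}

/-! ### Solitons outside of the cone -/

theorem re_I_mul_theta (α β x : ℝ) (ht : t ≠ 0) (w : ℂ) :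
    (Complex.I * theta α β x t w).re = w.im * (velocity α β w * t - x) / t := by
  rw [Complex.I_mul_re, theta, velocity]
  simp only [Complex.add_im, Complex.mul_im, Complex.mul_re, Complex.ofReal_re, Complex.ofReal_im,
    pow_succ, pow_zero, one_mul, Complex.re_ofNat, Complex.im_ofNat]
  field_simp
  ring

theorem norm_gammaCoeff (α β x : ℝ) (ht : t ≠ 0) (w : ℂ) :
    ‖gammaCoeff α β D x t w‖ = ‖D.c w‖ * Real.exp (2 * (w.im * (velocity α β w * t - x))) := by
  rw [gammaCoeff, norm_mul, Complex.norm_exp]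
  have : (2 * Complex.I * (t : ℂ) * theta α β x t w) =
      ((2 * t : ℝ) : ℂ) * (Complex.I * theta α β x t w) := by
    push_cast
    ring
  rw [this, Complex.re_ofReal_mul, re_I_mul_theta α β x ht]
  congr 2
  field_simp

/-- In the cone, the distance to a soliton slower or faster than the cone grows linearly; here `v`
is the velocity of the soliton and `d` a lower bound for its distance from `[v₁, v₂]`. -/
theorem cone_estimate (h : (x, t) ∈ cone x₁ x₂ v₁ v₂) {v d : ℝ} :
    (0 ≤ t → d ≤ v₁ - v → v * t - x ≤ |x₁| + |x₂| - d * |t|) ∧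
    (0 ≤ t → d ≤ v - v₂ → x - v * t ≤ |x₁| + |x₂| - d * |t|) ∧
    (t ≤ 0 → d ≤ v₁ - v → x - v * t ≤ |x₁| + |x₂| - d * |t|) ∧
    (t ≤ 0 → d ≤ v - v₂ → v * t - x ≤ |x₁| + |x₂| - d * |t|) := by
  obtain ⟨x₀, ⟨hx1, hx2⟩, u, ⟨hu1, hu2⟩, hxt : x = x₀ + u * t⟩ := h
  subst hxt
  have h1 := neg_abs_le x₁
  have h2 := le_abs_self x₂
  have h3 := abs_nonneg x₁
  have h4 := abs_nonneg x₂
  refine ⟨fun ht hd => ?_, fun ht hd => ?_, fun ht hd => ?_, fun ht hd => ?_⟩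
  · rw [abs_of_nonneg ht]
    have := mul_le_mul_of_nonneg_right (by linarith : d ≤ u - v) ht
    linarith
  · rw [abs_of_nonneg ht]
    have := mul_le_mul_of_nonneg_right (by linarith : d ≤ v - u) ht
    linarith
  · rw [abs_of_nonpos ht]
    have := mul_le_mul_of_nonneg_right (by linarith : d ≤ u - v) (neg_nonneg.mpr ht)
    linarith
  · rw [abs_of_nonpos ht]
    have := mul_le_mul_of_nonneg_right (by linarith : d ≤ v - u) (neg_nonneg.mpr ht)
    linarith

/-- The comparison with `κ` a multiple of `exp (-8 ν |t|)`: at each removed eigenvalue `w`, the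
quantity `v(w) t - x` has to be less than `X - d w |t|` outside of `F`, and its negative in `F`. -/
theorem exists_exp_comparison (α β : ℝ) (D D' : ReflectionlessData) (hKZ : D'.Z ⊆ D.Z)
    (hF : F ⊆ D.Z) (hFK : Disjoint F D'.Z) (hc : ∀ w ∈ D'.Z, D'.c w = D.c w * s11 F w ^ 2)
    {r : ℝ} (hr : 0 < r) (X ν : ℝ) (d : ℂ → ℝ)
    (hd : ∀ w ∈ D.Z, w ∉ D'.Z → 0 < d w ∧ 4 * ν ≤ w.im * d w) :
    ∃ C T : ℝ, 0 < T ∧ ∀ x t, T ≤ |t| →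
      (∀ w ∈ D.Z, w ∉ D'.Z → w ∉ F → velocity α β w * t - x ≤ X - d w * |t|) →
      (∀ w ∈ F, x - velocity α β w * t ≤ X - d w * |t|) →
      ∀ Δ Δ' : Finset ℂ, ((∀ w ∈ D.Z, w ∉ D'.Z → X < d w * |t|) →
        ∀ z, s11 Δ z = s11 F z * s11 Δ' z) →
      ∀ m mI, IsRHSolution α β D x t m → IsRHSolution α β D' x t mI →
        LeftClose D (D.Z \ D'.Z) r (C * Real.exp (-8 * ν * |t|)) (mDelta m Δ) (mDelta mI Δ') ∧
        ∃ q qI : ℂ, Reconstructs m q ∧ Reconstructs mI qI ∧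
          ‖q - qI‖ ≤ C * Real.exp (-8 * ν * |t|) := by
  obtain ⟨C, hC0, hC⟩ := exists_comparison D D' hKZ hF hFK hc hr
  -- Both `‖c w‖` and `‖c w‖⁻¹` enter: `F` calls for upper bounds of the inverse coefficients.
  set k : ℂ → ℝ := fun w => (‖D.c w‖ + ‖D.c w‖⁻¹) * Real.exp (2 * (w.im * X))
  have hk : ∀ w, k w = (‖D.c w‖ + ‖D.c w‖⁻¹) * Real.exp (2 * (w.im * X)) := fun _ => rfl
  have hk0 : ∀ w, 0 ≤ k w := fun w => by positivity
  have hkle : ∀ w ∈ D.Z, k w ≤ ∑ w ∈ D.Z, k w := fun w hw =>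
    Finset.single_le_sum (fun w _ => hk0 w) hw
  -- The second constant ensures that `X < d w |t|` at the removed eigenvalues.
  refine ⟨C * ∑ w ∈ D.Z, k w, 1 + ∑ w ∈ D.Z, |X / d w|, by positivity, ?_⟩
  intro x t hT hsmall hlarge Δ Δ' hΔ m mI hm hmI
  have htpos : 0 < |t| := lt_of_lt_of_le (by positivity) hT
  have ht : t ≠ 0 := abs_pos.mp htpos
  have hexp : ∀ w ∈ D.Z, w ∉ D'.Z → ∀ y, y ≤ X - d w * |t| →
      Real.exp (2 * (w.im * y)) ≤ Real.exp (2 * (w.im * X)) * Real.exp (-8 * ν * |t|) := by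
    intro w hw hw' y hy
    rw [← Real.exp_add, Real.exp_le_exp]
    have h1 := mul_le_mul_of_nonneg_left hy (D.im_pos w hw).le
    have h2 := mul_le_mul_of_nonneg_right (hd w hw hw').2 htpos.le
    linarith
  rw [mul_assoc C]
  refine hC α β x t _ (mul_nonneg (Finset.sum_nonneg fun w _ => hk0 w) (Real.exp_nonneg _))
    (fun w hw hw' hwF => ?_) (fun w hwF => ?_) Δ Δ' (hΔ fun w hw hw' => ?_) m mI hm hmI
  · rw [norm_gammaCoeff α β x ht]
    calc _ ≤ ‖D.c w‖ * (Real.exp (2 * (w.im * X)) * Real.exp (-8 * ν * |t|)) :=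
          mul_le_mul_of_nonneg_left (hexp w hw hw' _ (hsmall w hw hw' hwF)) (norm_nonneg _)
      _ = ‖D.c w‖ * Real.exp (2 * (w.im * X)) * Real.exp (-8 * ν * |t|) := (mul_assoc _ _ _).symm
      _ ≤ k w * Real.exp (-8 * ν * |t|) := by
          rw [hk]
          gcongr
          exact le_add_of_nonneg_right (by positivity)
      _ ≤ _ := mul_le_mul_of_nonneg_right (hkle w hw) (Real.exp_nonneg _)
  · have hw := hF hwF
    have hw' : w ∉ D'.Z := Finset.disjoint_left.mp hFK hwF
    have hc0 : 0 < ‖D.c w‖ := norm_pos_iff.mpr (D.c_ne_zero w hw)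
    have h1 := hexp w hw hw' _ (hlarge w hwF)
    rw [norm_gammaCoeff α β x ht]
    set E := Real.exp (2 * (w.im * (velocity α β w * t - x))) with hE
    have hinv : Real.exp (2 * (w.im * (x - velocity α β w * t))) * E = 1 := by
      rw [hE, ← Real.exp_add, Real.exp_eq_one_iff]
      ring
    have h2 : ‖D.c w‖⁻¹ * (Real.exp (2 * (w.im * X)) * Real.exp (-8 * ν * |t|)) ≤
        (∑ w ∈ D.Z, k w) * Real.exp (-8 * ν * |t|) := by
      rw [← mul_assoc]
      refine mul_le_mul_of_nonneg_right (le_trans ?_ (hkle w hw)) (Real.exp_nonneg _)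
      rw [hk]
      gcongr
      exact le_add_of_nonneg_left hc0.le
    calc 1 = ‖D.c w‖⁻¹ * Real.exp (2 * (w.im * (x - velocity α β w * t))) * (‖D.c w‖ * E) := by
          rw [mul_mul_mul_comm, hinv, inv_mul_cancel₀ hc0.ne', mul_one]
      _ ≤ _ := by
          refine mul_le_mul_of_nonneg_right (le_trans ?_ h2) (by positivity)
          exact mul_le_mul_of_nonneg_left h1 (by positivity)
  · rw [← div_lt_iff₀' (hd w hw hw').1]
    have h1 := Finset.single_le_sum (f := fun w => |X / d w|) (fun w _ => abs_nonneg _) hw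
    have h2 := le_abs_self (X / d w)
    linarith

theorem s11_eq_mul_of_mem_iff (hdisj : Disjoint F Δ') (h : ∀ w, w ∈ Δ ↔ w ∈ F ∨ w ∈ Δ') (z : ℂ) :
    s11 Δ z = s11 F z * s11 Δ' z := by
  classical
  have : Δ = F ∪ Δ' := Finset.ext fun w => by rw [h, Finset.mem_union]
  rw [this, s11, Finset.prod_union hdisj]
  rfl

/-- Lower bounds for the distance of the velocity of a removed soliton from `[v₁, v₂]`. -/
theorem infDist_velocity (hv : v₁ ≤ v₂) {ν : ℝ} (hν : (ν : EReal) ≤ mu α β D v₁ v₂)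
    (hw : w ∈ D.Z) (hwK : w ∉ keep α β D v₁ v₂) :
    0 < Metric.infDist (velocity α β w) (Set.Icc v₁ v₂) ∧
      4 * ν ≤ w.im * Metric.infDist (velocity α β w) (Set.Icc v₁ v₂) := by
  have hmem : velocity α β w ∉ Set.Icc v₁ v₂ := fun h => hwK (Finset.mem_filter.mpr ⟨hw, h⟩)
  refine ⟨(isClosed_Icc.notMem_iff_infDist_pos (Set.nonempty_Icc.mpr hv)).mp hmem, ?_⟩
  have h1 := hν.trans (Finset.inf_le (Finset.mem_sdiff.mpr ⟨hw, hwK⟩))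
  rw [EReal.coe_le_coe_iff] at h1
  linarith

theorem infDist_le_of_lt (hv : v₁ ≤ v₂) {v : ℝ} (h : v < v₁) :
    Metric.infDist v (Set.Icc v₁ v₂) ≤ v₁ - v := by
  have := Metric.infDist_le_dist_of_mem (x := v) (Set.left_mem_Icc.mpr hv)
  rwa [Real.dist_eq, abs_sub_comm, abs_of_pos (sub_pos.mpr h)] at this

theorem infDist_le_of_gt (hv : v₁ ≤ v₂) {v : ℝ} (h : v₂ < v) :
    Metric.infDist v (Set.Icc v₁ v₂) ≤ v - v₂ := by
  have := Metric.infDist_le_dist_of_mem (x := v) (Set.right_mem_Icc.mpr hv)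
  rwa [Real.dist_eq, abs_of_pos (sub_pos.mpr h)] at this

theorem mem_keep : w ∈ keep α β D v₁ v₂ ↔ w ∈ D.Z ∧ v₁ ≤ velocity α β w ∧ velocity α β w ≤ v₂ :=
  Finset.mem_filter

theorem mem_faster : w ∈ faster α β D v₂ ↔ w ∈ D.Z ∧ v₂ < velocity α β w := Finset.mem_filter

theorem mem_slower : w ∈ slower α β D v₁ ↔ w ∈ D.Z ∧ velocity α β w < v₁ := Finset.mem_filter

theorem disjoint_faster_keep : Disjoint (faster α β D v₂) (keep α β D v₁ v₂) :=
  Finset.disjoint_left.mpr fun _ h h' => not_lt.mpr (mem_keep.mp h').2.2 (mem_faster.mp h).2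

theorem disjoint_slower_keep : Disjoint (slower α β D v₁) (keep α β D v₁ v₂) :=
  Finset.disjoint_left.mpr fun _ h h' => not_lt.mpr (mem_keep.mp h').2.1 (mem_slower.mp h).2

theorem lt_of_notMem_keep_of_notMem_faster (hw : w ∈ D.Z) (hwK : w ∉ keep α β D v₁ v₂)
    (hwF : w ∉ faster α β D v₂) : velocity α β w < v₁ :=
  lt_of_not_ge fun h => hwK (mem_keep.mpr ⟨hw, h, le_of_not_gt fun h' =>
    hwF (mem_faster.mpr ⟨hw, h'⟩)⟩)

theorem lt_of_notMem_keep_of_notMem_slower (hw : w ∈ D.Z) (hwK : w ∉ keep α β D v₁ v₂)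
    (hwF : w ∉ slower α β D v₁) : v₂ < velocity α β w :=
  lt_of_not_ge fun h => hwK (mem_keep.mpr ⟨hw, le_of_not_gt fun h' =>
    hwF (mem_slower.mpr ⟨hw, h'⟩), h⟩)

end Hirota

theorem proposition6 (α β : ℝ) (D : Hirota.ReflectionlessData)
    (x₁ x₂ v₁ v₂ : ℝ) (hx : x₁ ≤ x₂) (hv : v₁ ≤ v₂) :
    -- the normalized solution exists and is unique away from its poles
    (∀ x t : ℝ, t ≠ 0 → ∃ m, Hirota.IsRHSolution α β D x t m ∧
      ∀ m', Hirota.IsRHSolution α β D x t m' →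
        Set.EqOn m' m (Hirota.conjUnion D.Z)ᶜ) ∧
    -- `t → +∞`
    (∀ ν : ℝ, (ν : EReal) ≤ Hirota.mu α β D v₁ v₂ → ∀ r : ℝ, 0 < r →
      ∃ C T : ℝ, 0 < T ∧ ∀ x t : ℝ, (x, t) ∈ Hirota.cone x₁ x₂ v₁ v₂ → T ≤ t →
        ∀ m mI, Hirota.IsRHSolution α β D x t m →
          Hirota.IsRHSolution α β (Hirota.dataPlus α β D v₁ v₂) x t mI →
          Hirota.LeftClose D (Hirota.removed α β D v₁ v₂) r (C * Real.exp (-8 * ν * t))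
            (Hirota.mDelta m (Hirota.deltaMinus α β D x t))
            (Hirota.mDelta mI
              (Hirota.deltaMinus α β (Hirota.dataPlus α β D v₁ v₂) x t)) ∧
          ∃ q qI : ℂ, Hirota.Reconstructs m q ∧ Hirota.Reconstructs mI qI ∧
            ‖q - qI‖ ≤ C * Real.exp (-8 * ν * t)) ∧
    -- `t → -∞`
    (∀ ν : ℝ, (ν : EReal) ≤ Hirota.mu α β D v₁ v₂ → ∀ r : ℝ, 0 < r →
      ∃ C T : ℝ, 0 < T ∧ ∀ x t : ℝ, (x, t) ∈ Hirota.cone x₁ x₂ v₁ v₂ → t ≤ -T →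
        ∀ m mI, Hirota.IsRHSolution α β D x t m →
          Hirota.IsRHSolution α β (Hirota.dataMinus α β D v₁ v₂) x t mI →
          Hirota.LeftClose D (Hirota.removed α β D v₁ v₂) r (C * Real.exp (-8 * ν * |t|))
            (Hirota.mDelta m (Hirota.deltaPlus α β D x t))
            (Hirota.mDelta mI
              (Hirota.deltaPlus α β (Hirota.dataMinus α β D v₁ v₂) x t)) ∧
          ∃ q qI : ℂ, Hirota.Reconstructs m q ∧ Hirota.Reconstructs mI qI ∧
            ‖q - qI‖ ≤ C * Real.exp (-8 * ν * |t|)) := by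
  classical
  refine ⟨fun x t _ => ?_, fun ν hν r hr => ?_, fun ν hν r hr => ?_⟩
  · obtain ⟨m, hm⟩ := Hirota.exists_isRHSolution α β D x t
    exact ⟨m, hm, fun m' hm' => hm'.eqOn hm⟩
  · obtain ⟨C, T, hT, h⟩ := Hirota.exists_exp_comparison α β D (Hirota.dataPlus α β D v₁ v₂)
      (Finset.filter_subset _ _) (F := Hirota.faster α β D v₂) (Finset.filter_subset _ _)
      Hirota.disjoint_faster_keep
      (fun w _ => by rw [Hirota.s11, ← Finset.prod_pow]; rfl) hr (|x₁| + |x₂|) ν _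
      (fun w => Hirota.infDist_velocity hv hν)
    refine ⟨C, T, hT, fun x t hxt htT => ?_⟩
    have ht : 0 < t := hT.trans_le htT
    have hslow : ∀ w, Hirota.velocity α β w < v₁ → _ := fun w hw =>
      (Hirota.cone_estimate hxt).1 ht.le (Hirota.infDist_le_of_lt hv hw)
    have hfast : ∀ w, v₂ < Hirota.velocity α β w → _ := fun w hw =>
      (Hirota.cone_estimate hxt).2.1 ht.le (Hirota.infDist_le_of_gt hv hw)
    have key := h x t (by rwa [abs_of_pos ht])
      (fun w hw hwK hwF => hslow w (Hirota.lt_of_notMem_keep_of_notMem_faster hw hwK hwF))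
      (fun w hw => hfast w (Hirota.mem_faster.mp hw).2)
      (Hirota.deltaMinus α β D x t) (Hirota.deltaMinus α β (Hirota.dataPlus α β D v₁ v₂) x t)
      -- For large `t`, the set `△⁻` consists of the fast eigenvalues and its kept elements.
      (fun hX => Hirota.s11_eq_mul_of_mem_iff
        (Hirota.disjoint_faster_keep.mono_right (Finset.filter_subset _ _)) fun w => by
        simp only [Hirota.deltaMinus, Finset.mem_filter, Hirota.re_I_mul_theta α β x ht.ne']
        constructor
        · rintro ⟨hw, hpos⟩
          by_cases hwF : w ∈ Hirota.faster α β D v₂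
          · exact Or.inl hwF
          · refine Or.inr ⟨?_, hpos⟩
            by_contra hwK
            have h1 := hslow w (Hirota.lt_of_notMem_keep_of_notMem_faster hw hwK hwF)
            have h2 := hX w hw hwK
            exact absurd hpos (not_lt.mpr (div_nonpos_of_nonpos_of_nonneg
              (mul_nonpos_of_nonneg_of_nonpos (D.im_pos w hw).le (by linarith)) ht.le))
        · rintro (hwF | ⟨hwK, hpos⟩)
          · obtain ⟨hw, hvw⟩ := Hirota.mem_faster.mp hwF
            have h1 := hfast w hvw
            have h2 := hX w hw (Finset.disjoint_left.mp Hirota.disjoint_faster_keep hwF)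
            exact ⟨hw, div_pos (mul_pos (D.im_pos w hw) (by linarith)) ht⟩
          · exact ⟨(Hirota.mem_keep.mp hwK).1, hpos⟩)
    rwa [abs_of_pos ht] at key
  · obtain ⟨C, T, hT, h⟩ := Hirota.exists_exp_comparison α β D (Hirota.dataMinus α β D v₁ v₂)
      (Finset.filter_subset _ _) (F := Hirota.slower α β D v₁) (Finset.filter_subset _ _)
      Hirota.disjoint_slower_keep
      (fun w _ => by rw [Hirota.s11, ← Finset.prod_pow]; rfl) hr (|x₁| + |x₂|) ν _
      (fun w => Hirota.infDist_velocity hv hν)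
    refine ⟨C, T, hT, fun x t hxt htT => ?_⟩
    have ht : t < 0 := by linarith
    have hslow : ∀ w, Hirota.velocity α β w < v₁ → _ := fun w hw =>
      (Hirota.cone_estimate hxt).2.2.1 ht.le (Hirota.infDist_le_of_lt hv hw)
    have hfast : ∀ w, v₂ < Hirota.velocity α β w → _ := fun w hw =>
      (Hirota.cone_estimate hxt).2.2.2 ht.le (Hirota.infDist_le_of_gt hv hw)
    exact h x t (by rw [abs_of_neg ht]; linarith)
      (fun w hw hwK hwF => hfast w (Hirota.lt_of_notMem_keep_of_notMem_slower hw hwK hwF))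
      (fun w hw => hslow w (Hirota.mem_slower.mp hw).2)
      (Hirota.deltaPlus α β D x t) (Hirota.deltaPlus α β (Hirota.dataMinus α β D v₁ v₂) x t)
      -- For large `-t`, the set `△⁺` consists of the slow eigenvalues and its kept elements.
      (fun hX => Hirota.s11_eq_mul_of_mem_iff
        (Hirota.disjoint_slower_keep.mono_right (Finset.filter_subset _ _)) fun w => by
        simp only [Hirota.deltaPlus, Finset.mem_filter, Hirota.re_I_mul_theta α β x ht.ne]
        constructor
        · rintro ⟨hw, hneg⟩
          by_cases hwF : w ∈ Hirota.slower α β D v₁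
          · exact Or.inl hwF
          · refine Or.inr ⟨?_, hneg⟩
            by_contra hwK
            have h1 := hfast w (Hirota.lt_of_notMem_keep_of_notMem_slower hw hwK hwF)
            have h2 := hX w hw hwK
            exact absurd hneg (not_lt.mpr (div_nonneg_of_nonpos
              (mul_nonpos_of_nonneg_of_nonpos (D.im_pos w hw).le (by linarith)) ht.le))
        · rintro (hwF | ⟨hwK, hneg⟩)
          · obtain ⟨hw, hvw⟩ := Hirota.mem_slower.mp hwF
            have h1 := hslow w hvw
            have h2 := hX w hw (Finset.disjoint_left.mp Hirota.disjoint_slower_keep hwF)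
            exact ⟨hw, div_neg_of_pos_of_neg (mul_pos (D.im_pos w hw) (by linarith)) ht⟩
          · exact ⟨(Hirota.mem_keep.mp hwK).1, hneg⟩)
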